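/- Let $\rho\in(-1,1)\setminus\{0\}$, $\varepsilon\in\mathbb R$ with $|\rho+\varepsilon|>|\rho|$, and let $h\ge 1$ be a fixed integer. Let $(z_t)_{t\ge1}$ be white noise with variance $1$ (square integrable, mean zero, pairwise uncorrelated). For each $n$ let $k=k(n)\in\mathbb N$, and assume $k(n)\to\infty$ and $n-k(n)\to\infty$ as $n\to\infty$. Let $y_0=0$ and $y_t=\rho_t y_{t-1}+z_t$ for $t\ge1$, where $\rho_t=\rho+\varepsilon$ if $k\le t\le k+h-1$ and $\rho_t=\rho$ otherwise, and let $B_n$ be the precision matrix (inverse covariance matrix) of $(y_1,\dots,y_n)$. For Hermitian matrices $A_n\in\mathbb R^{n\times n}$ whose empirical spectral distributions converge weakly to a compactly supported probability measure $\mu$, a point $x\in\mathbb R$ is an outlier of $\{A_n\}$ if $\lim_{n\to\infty}\min_{y\in spec(A_n)}|x-y|=0$ and $x\notin \overline{supp(\mu)}$; $out(\{A_n\})$ is the set of outliers. If $\overline{supp(\mu)}=[a,b]$, let $out_L(\{A_n\})=out(\{A_n\})\cap(-\infty,a)$ and $out_R(\{A_n\})=out(\{A_n\})\cap(b,\infty)$.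 (For $\{B_n\}$ the measure $\mu$ exists and its support is $[a_\rho,b_\rho]$, with $a_\rho=(1-|\rho|)^2$ and $b_\rho=(1+|\rho|)^2$.) Put $x_j=1+(\varepsilon+\rho)^2-2(\varepsilon+\rho)\cos(j\pi/h)$ for $1\le j\le h-1$; $x_0=-\infty$, $x_h=\infty$ if $\rho>0$; and $x_0=\infty$, $x_h=-\infty$ if $\rho<0$. Assume $(x_j-a_\rho)(x_j-b_\rho)\ne0$ for $1\le j\le h-1$. Let $p=|\{0\le j\le h: x_j<a_\rho\}|$ and $q=|\{0\le \ell\le h: x_\ell>b_\rho\}|$. Then $$|out_L(\{B_n\})|\ge p\qquad\text{and}\qquad |out_R(\{B_n\})|\ge q .$$ Suppose furthermore that $\rho$ and $\rho+\varepsilon$ have the same sign, and define $$I^{(L)}_j=\begin{cases}(x_{j-1}\vee0,\;x_j\wedge a_\rho)&\rho>0\\(x_{h+1-j}\vee0,\;x_{h-j}\wedge a_\rho)&\rho<0\end{cases}\qquad I^{(R)}_\ell=\begin{cases}(b_\rho\vee x_{h-\ell},\;x_{h+1-\ell})&\rho>0\\(b_\rho\vee x_\ell,\;x_{\ell-1})&\rho<0.\end{cases}$$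 Then $I^{(L)}_j\cap out_L(\{B_n\})\neq\emptyset$ for $1\le j\le p$ and $I^{(R)}_\ell\cap out_R(\{B_n\})\ne\emptyset$ for $1\le\ell\le q$. -/

import Mathlib

open MeasureTheory ProbabilityTheory Filter Topology
open scoped ENNReal BoundedContinuousFunction

noncomputable section

namespace SCM

/-- White noise with unit variance: centred, square integrable, variance one, and pairwise
uncorrelated random variables `z 1, z 2, …` (the value `z 0` plays no role). -/
structure IsWhiteNoise {Ω : Type*} [MeasurableSpace Ω] (P : Measure Ω) (z : ℕ → Ω → ℝ) :
    Prop where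
  memLp : ∀ t, 1 ≤ t → MemLp (z t) 2 P
  mean_zero : ∀ t, 1 ≤ t → ∫ ω, z t ω ∂P = 0
  variance_one : ∀ t, 1 ≤ t → Var[z t; P] = 1
  uncorrelated : ∀ s t, 1 ≤ s → 1 ≤ t → s ≠ t → cov[z s, z t; P] = 0

/-- The autoregressive process `y 0 = 0`, `y t = r t * y (t - 1) + z t` for `t ≥ 1`. -/
def arProcess {Ω : Type*} (r : ℕ → ℝ) (z : ℕ → Ω → ℝ) : ℕ → Ω → ℝ
  | 0 => fun _ => 0
  | t + 1 => fun ω => r (t + 1) * arProcess r z t ω + z (t + 1) ω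

/-- The covariance matrix of `(y 1, …, y n)`. -/
def covMatrix {Ω : Type*} [MeasurableSpace Ω] (P : Measure Ω) (y : ℕ → Ω → ℝ) (n : ℕ) :
    Matrix (Fin n) (Fin n) ℝ :=
  Matrix.of fun i j => cov[y ((i : ℕ) + 1), y ((j : ℕ) + 1); P]

/-- The precision matrix (inverse covariance matrix) of `(y 1, …, y n)`. -/
def precisionMatrix {Ω : Type*} [MeasurableSpace Ω] (P : Measure Ω) (y : ℕ → Ω → ℝ) (n : ℕ) :
    Matrix (Fin n) (Fin n) ℝ :=
  (covMatrix P y n)⁻¹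

/-- The coefficients of the single interval structural change model: `ρ + ε` at the times
`k, …, k + h - 1` and `ρ` at all other times. -/
def arCoeff (ρ ε : ℝ) (k h : ℕ) (t : ℕ) : ℝ :=
  ρ + (Set.Icc k (k + h - 1)).indicator (fun _ => ε) t

/-- The sequence `B_n` of precision matrices of `(y 1, …, y n)` in the single interval structural
change model with break point `k n` (which may vary with the sample size) and length `h`. -/
def scmPrecision {Ω : Type*} [MeasurableSpace Ω] (P : Measure Ω) (z : ℕ → Ω → ℝ)
    (ρ ε : ℝ) (k : ℕ → ℕ) (h : ℕ) (n : ℕ) : Matrix (Fin n) (Fin n) ℝ :=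
  precisionMatrix P (arProcess (arCoeff ρ ε (k n) h) z) n

/-- The empirical spectral distribution `n⁻¹ ∑ᵢ δ_{λᵢ(A)}` of a Hermitian matrix. -/
def esd {n : ℕ} {A : Matrix (Fin n) (Fin n) ℝ} (hA : A.IsHermitian) : Measure ℝ :=
  (n : ℝ≥0∞)⁻¹ • ∑ i, Measure.dirac (hA.eigenvalues i)

/-- `A` is a sequence of Hermitian matrices whose empirical spectral distributions converge
weakly to the compactly supported probability measure `μ`. -/
def IsASD (A : ∀ n : ℕ, Matrix (Fin n) (Fin n) ℝ) (μ : Measure ℝ) : Prop :=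
  IsProbabilityMeasure μ ∧ IsCompact μ.support ∧
    ∃ hA : ∀ n, (A n).IsHermitian,
      ∀ f : ℝ →ᵇ ℝ, Tendsto (fun n => ∫ x, f x ∂(esd (hA n))) atTop (𝓝 (∫ x, f x ∂μ))

/-- The outliers of the sequence `A`: limit points of the spectra (the distance from `x` to
`spec (A n)` tends to zero) outside the closed support of the asymptotic spectral distribution. -/
def out (A : ∀ n : ℕ, Matrix (Fin n) (Fin n) ℝ) : Set ℝ :=
  {x | ∃ μ : Measure ℝ, IsASD A μ ∧
    Tendsto (fun n => Metric.infDist x (spectrum ℝ (A n))) atTop (𝓝 0) ∧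
    x ∉ closure μ.support}

/-- The left outliers, when the support of the asymptotic spectral distribution is `[a, b]`. -/
def outL (A : ∀ n : ℕ, Matrix (Fin n) (Fin n) ℝ) : Set ℝ :=
  {x | x ∈ out A ∧ ∃ (μ : Measure ℝ) (a b : ℝ),
    IsASD A μ ∧ a ≤ b ∧ closure μ.support = Set.Icc a b ∧ x < a}

/-- The right outliers, when the support of the asymptotic spectral distribution is `[a, b]`. -/
def outR (A : ∀ n : ℕ, Matrix (Fin n) (Fin n) ℝ) : Set ℝ :=
  {x | x ∈ out A ∧ ∃ (μ : Measure ℝ) (a b : ℝ),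
    IsASD A μ ∧ a ≤ b ∧ closure μ.support = Set.Icc a b ∧ b < x}

/-- `a_ρ = (1 - |ρ|)²`. -/
def aBound (ρ : ℝ) : ℝ := (1 - |ρ|) ^ 2

/-- `b_ρ = (1 + |ρ|)²`. -/
def bBound (ρ : ℝ) : ℝ := (1 + |ρ|) ^ 2

/-- The real points `1 + (ε + ρ)² - 2 (ε + ρ) cos (j π / h)`, used for `0 < j < h`. -/
def xReal (ρ ε : ℝ) (h j : ℕ) : ℝ :=
  1 + (ε + ρ) ^ 2 - 2 * (ε + ρ) * Real.cos (j * Real.pi / h)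

/-- The points `x_0, …, x_h`, with the two end points infinite. -/
def xPt (ρ ε : ℝ) (h j : ℕ) : EReal :=
  if j = 0 then (if 0 < ρ then ⊥ else ⊤)
  else if j = h then (if 0 < ρ then ⊤ else ⊥)
  else ((xReal ρ ε h j : ℝ) : EReal)

/-- The number `p` of indices `0 ≤ j ≤ h` with `x_j < a_ρ`. -/
def numL (ρ ε : ℝ) (h : ℕ) : ℕ :=
  {j : ℕ | j ≤ h ∧ xPt ρ ε h j < ((aBound ρ : ℝ) : EReal)}.ncard

/-- The number `q` of indices `0 ≤ ℓ ≤ h` with `x_ℓ > b_ρ`. -/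
def numR (ρ ε : ℝ) (h : ℕ) : ℕ :=
  {l : ℕ | l ≤ h ∧ ((bBound ρ : ℝ) : EReal) < xPt ρ ε h l}.ncard

/-- The set of real numbers in the open interval `(u, v)` with extended real end points. -/
def realIoo (u v : EReal) : Set ℝ := {x : ℝ | u < (x : EReal) ∧ (x : EReal) < v}

/-- The interval `I_j^{(L)}`, used for `1 ≤ j ≤ p`. -/
def intervalL (ρ ε : ℝ) (h j : ℕ) : Set ℝ :=
  if 0 < ρ then
    realIoo (max (xPt ρ ε h (j - 1)) 0) (min (xPt ρ ε h j) ((aBound ρ : ℝ) : EReal))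
  else
    realIoo (max (xPt ρ ε h (h + 1 - j)) 0) (min (xPt ρ ε h (h - j)) ((aBound ρ : ℝ) : EReal))

/-- The interval `I_ℓ^{(R)}`, used for `1 ≤ ℓ ≤ q`. -/
def intervalR (ρ ε : ℝ) (h l : ℕ) : Set ℝ :=
  if 0 < ρ then
    realIoo (max ((bBound ρ : ℝ) : EReal) (xPt ρ ε h (h - l))) (xPt ρ ε h (h + 1 - l))
  else
    realIoo (max ((bBound ρ : ℝ) : EReal) (xPt ρ ε h l)) (xPt ρ ε h (l - 1))

end SCM

end

/-! Whitening gives `B_n = LᵀL` with `L` the bidiagonal matrix taking `y` to the innovations. So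
`B_n` is a Jacobi matrix with off-diagonal entries `-r` and diagonal entries `1 + r²`, except for
the last one, which is `1`. Away from the break it is a section of the Laurent operator with symbol
`1 + ρ² - 2ρ cos θ`. The moment method gives the law of this symbol as limit, with support `[a_ρ,
b_ρ]` (`isASD_jacobiMatrix`, `support_symbolLaw`).

Around the break, `B_n` looks like a bi-infinite Jacobi operator with coupling `σ = ρ + ε` on `h`
consecutive bonds and `ρ` elsewhere. If this operator has an eigenvector for `x` that vanishes at
both infinities, its sections are approximate eigenvectors of `B_n`, since both boundaries recede
from the break. Hence `x` is a limit of spectra (`tendsto_infDist_spectrum_jacobiMatrix`).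

Outside the band such an eigenvector is geometric off the break and a combination of Chebyshev
polynomials `U_m(c)`, `c = (1 + σ² - x)/(2σ)`, on it. Matching the pieces gives the scalar equation
`secular = 0` (`exists_boundState`). By parity of `U_m` only `s = |ρ|` and `τ = |σ|` matter. The
points `x_j` are the zeros of `U_{h-1}(c)`, and at those outside the band the secular function is
nonzero with alternating signs. Its sign is also known at the band edges (where `τ > s` enters), at
`0` and near `+∞`. The intermediate value theorem then puts a zero in each gap
(`exists_secularAt_zero_left`, `exists_secularAt_zero_right`). It remains to count gaps. -/

namespace SCM
open Matrix

/-! ### The precision matrix as a Jacobi matrix. -/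

/-- The lower bidiagonal matrix sending `(y 1, …, y n)` to the innovations `(z 1, …, z n)`. -/
noncomputable def innovationMatrix (r : ℕ → ℝ) (n : ℕ) : Matrix (Fin n) (Fin n) ℝ :=
  Matrix.of fun i j => (if j = i then 1 else 0) - (if (j : ℕ) + 1 = i then r (i + 1) else 0)

lemma innovationMatrix_mulVec (r : ℕ → ℝ) {n : ℕ} (f : ℕ → ℝ) (i : Fin n) :
    (innovationMatrix r n *ᵥ fun j => f j) i =
      f i - if 1 ≤ (i : ℕ) then r (i + 1) * f (i - 1) else 0 := by
  simp only [mulVec, dotProduct, innovationMatrix, of_apply, sub_mul, Finset.sum_sub_distrib,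
    ite_mul, one_mul, zero_mul, Finset.sum_ite_eq', Finset.mem_univ, if_true]
  congr 1
  split_ifs with h
  · rw [Finset.sum_eq_single (⟨i - 1, by omega⟩ : Fin n)]
    · rw [if_pos (by simp; omega)]
    · intro b _ hb
      rw [if_neg]
      intro h'
      exact hb (Fin.ext (by simp; omega))
    · simp
  · exact Finset.sum_eq_zero fun b _ => if_neg (by omega)

lemma innovationMatrix_transpose_mulVec (r : ℕ → ℝ) {n : ℕ} (f : ℕ → ℝ) (i : Fin n) :
    ((innovationMatrix r n)ᵀ *ᵥ fun j => f j) i =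
      f i - if (i : ℕ) + 1 < n then r (i + 2) * f (i + 1) else 0 := by
  simp only [mulVec, dotProduct, innovationMatrix, transpose_apply, of_apply, sub_mul,
    Finset.sum_sub_distrib, ite_mul, one_mul, zero_mul, Finset.sum_ite_eq, Finset.mem_univ, if_true]
  congr 1
  split_ifs with h
  · rw [Finset.sum_eq_single (⟨i + 1, h⟩ : Fin n)]
    · simp
    · intro b _ hb
      rw [if_neg]
      intro h'
      exact hb (Fin.ext h'.symm)
    · simp
  · exact Finset.sum_eq_zero fun b _ => if_neg (by omega)

/-- The tridiagonal matrix `Lᵀ L` for `L` the innovation matrix. -/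
noncomputable def jacobiMatrix (r : ℕ → ℝ) (n : ℕ) : Matrix (Fin n) (Fin n) ℝ :=
  (innovationMatrix r n)ᵀ * innovationMatrix r n

lemma jacobiMatrix_isHermitian (r : ℕ → ℝ) (n : ℕ) : (jacobiMatrix r n).IsHermitian := by
  simp [jacobiMatrix, Matrix.IsHermitian, conjTranspose_eq_transpose_of_trivial, transpose_mul]

/-- The bond between positions `i` and `i + 1` carries `r (i + 2)`, because position `i` stands for
time `i + 1`. The last row has no term `r²`, since no later innovation involves the last
observation. -/
lemma jacobiMatrix_mulVec (r : ℕ → ℝ) {n : ℕ} (f : ℕ → ℝ) (i : Fin n) :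
    (jacobiMatrix r n *ᵥ fun j => f j) i =
      f i - (if 1 ≤ (i : ℕ) then r (i + 1) * f (i - 1) else 0) +
        if (i : ℕ) + 1 < n then r (i + 2) ^ 2 * f i - r (i + 2) * f (i + 1) else 0 := by
  have h1 : (innovationMatrix r n *ᵥ fun j => f j) =
      fun j : Fin n => (fun m : ℕ => f m - if 1 ≤ m then r (m + 1) * f (m - 1) else 0) j := by
    funext j
    exact innovationMatrix_mulVec r f j
  rw [jacobiMatrix, ← mulVec_mulVec, h1, innovationMatrix_transpose_mulVec r
    (fun m : ℕ => f m - if 1 ≤ m then r (m + 1) * f (m - 1) else 0)]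
  simp only [le_add_iff_nonneg_left, zero_le, if_true, Nat.add_sub_cancel]
  split_ifs <;> ring

section Covariance
variable {Ω : Type*} [MeasurableSpace Ω] {P : Measure Ω} {z : ℕ → Ω → ℝ}

lemma memLp_arProcess (hz : IsWhiteNoise P z) (r : ℕ → ℝ) (t : ℕ) :
    MemLp (arProcess r z t) 2 P := by
  induction t with
  | zero => exact MemLp.zero
  | succ t ih => exact (ih.const_mul (r (t + 1))).add (hz.memLp (t + 1) (by omega))

variable [IsProbabilityMeasure P]

lemma covariance_arProcess_succ (hz : IsWhiteNoise P z) (r : ℕ → ℝ) (t : ℕ) {X : Ω → ℝ}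
    (hX : MemLp X 2 P) :
    cov[arProcess r z (t + 1), X; P] =
      r (t + 1) * cov[arProcess r z t, X; P] + cov[z (t + 1), X; P] := by
  have h : arProcess r z (t + 1) = r (t + 1) • arProcess r z t + z (t + 1) := by
    funext ω
    simp [arProcess]
  rw [h, covariance_add_left ((memLp_arProcess hz r t).const_smul _)
    (hz.memLp (t + 1) (by omega)) hX, covariance_smul_left]

/-- The `if` and the index `t - 1 + 1` reproduce the shape of `innovationMatrix_mulVec`. The case `t
= 0` is consistent because the process starts at `0`. -/
lemma covariance_innovation (hz : IsWhiteNoise P z) (r : ℕ → ℝ) (t : ℕ) {X : Ω → ℝ}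
    (hX : MemLp X 2 P) :
    cov[arProcess r z (t + 1), X; P] -
      (if 1 ≤ t then r (t + 1) * cov[arProcess r z (t - 1 + 1), X; P] else 0) =
        cov[z (t + 1), X; P] := by
  rw [covariance_arProcess_succ hz r t hX]
  rcases t with _ | t
  · have : arProcess r z 0 = 0 := rfl
    simp [this]
  · simp

/-- The precision matrix of an autoregressive process driven by white noise. -/
lemma precisionMatrix_arProcess (hz : IsWhiteNoise P z) (r : ℕ → ℝ) (n : ℕ) :
    precisionMatrix P (arProcess r z) n = jacobiMatrix r n := by
  have hy := memLp_arProcess hz r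
  set C := covMatrix P (arProcess r z) n with hC
  set L := innovationMatrix r n with hL
  have h1 : ∀ i b, (L * C) i b = cov[z ((i : ℕ) + 1), arProcess r z ((b : ℕ) + 1); P] := by
    intro i b
    rw [← covariance_innovation hz r i (hy _)]
    exact innovationMatrix_mulVec r
      (fun a => cov[arProcess r z (a + 1), arProcess r z ((b : ℕ) + 1); P]) i
  -- `L` whitens the process, so `L C Lᵀ` is the covariance matrix of the innovations.
  have h2 : L * C * Lᵀ = 1 := by
    ext i j
    have h3 : (L * C * Lᵀ) i j = (L *ᵥ fun b : Fin n =>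
        (fun m : ℕ => cov[arProcess r z (m + 1), z ((i : ℕ) + 1); P]) b) j := by
      simp only [mul_apply (M := L * C), h1, mulVec, dotProduct, transpose_apply]
      exact Finset.sum_congr rfl fun b _ => by rw [mul_comm, covariance_comm]
    have hzi := hz.memLp ((i : ℕ) + 1) (by omega)
    rw [h3, hL, innovationMatrix_mulVec r
      (fun m : ℕ => cov[arProcess r z (m + 1), z ((i : ℕ) + 1); P]),
      covariance_innovation hz r j hzi, one_apply]
    split_ifs with hij
    · rw [hij, covariance_self (hz.memLp _ (by omega)).aemeasurable]
      exact hz.variance_one _ (by omega)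
    · exact hz.uncorrelated _ _ (by omega) (by omega) fun h => hij (Fin.ext (by omega))
  rw [precisionMatrix, ← hC, jacobiMatrix, ← hL]
  refine inv_eq_right_inv ?_
  rw [Matrix.mul_assoc] at h2
  rw [← Matrix.mul_assoc]
  exact mul_eq_one_comm.mp h2

end Covariance

/-! ### Approximate eigenvectors from bound states. -/

/-- The distance from `x` to the spectrum of a symmetric matrix is bounded by the relative
residual of any approximate eigenvector. -/
lemma infDist_spectrum_sq_mul_le {n : ℕ} {A : Matrix (Fin n) (Fin n) ℝ} (hA : A.IsHermitian)
    (x : ℝ) (v : Fin n → ℝ) :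
    Metric.infDist x (spectrum ℝ A) ^ 2 * ∑ i, v i ^ 2 ≤ ∑ i, ((A *ᵥ v) i - x * v i) ^ 2 := by
  set e := hA.eigenvectorBasis with he
  set V : EuclideanSpace ℝ (Fin n) := WithLp.toLp 2 v with hV
  set W : EuclideanSpace ℝ (Fin n) := WithLp.toLp 2 (A *ᵥ v - x • v) with hW
  have hVn : ∑ i, v i ^ 2 = ‖V‖ ^ 2 := by
    rw [EuclideanSpace.norm_sq_eq]
    simp [hV]
  have hWn : ∑ i, ((A *ᵥ v) i - x * v i) ^ 2 = ‖W‖ ^ 2 := by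
    rw [EuclideanSpace.norm_sq_eq]
    simp [hW]
  -- In an eigenbasis the residual has coordinates `(λ_i - x)` times those of `v`, so Parseval
  -- reduces the claim to a comparison term by term.
  have hin : ∀ i, inner ℝ (e i) W = (hA.eigenvalues i - x) * inner ℝ (e i) V := by
    intro i
    have h1 : ∀ y : Fin n → ℝ, inner ℝ (e i) (WithLp.toLp 2 y) = ⇑(e i) ⬝ᵥ y := by
      intro y
      rw [EuclideanSpace.inner_eq_star_dotProduct]
      simp [dotProduct_comm]
    rw [hW, hV, h1, h1, dotProduct_sub, dotProduct_smul, dotProduct_mulVec,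
      ← mulVec_transpose, ← conjTranspose_eq_transpose_of_trivial, hA.eq, he,
      hA.mulVec_eigenvectorBasis, smul_dotProduct]
    simp only [smul_eq_mul]
    ring
  rw [hVn, hWn, ← e.sum_sq_norm_inner_right V, ← e.sum_sq_norm_inner_right W, Finset.mul_sum]
  refine Finset.sum_le_sum fun i _ => ?_
  rw [hin, norm_mul, mul_pow]
  gcongr
  · exact Metric.infDist_nonneg
  rw [Real.norm_eq_abs, abs_sub_comm, ← Real.dist_eq]
  exact Metric.infDist_le_dist_of_mem (hA.eigenvalues_mem_spectrum_real i)

/-- A decaying eigenvector of the bi-infinite Jacobi operator produces approximate eigenvectors of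
its finite sections. -/
lemma tendsto_infDist_spectrum_jacobiMatrix {c u : ℤ → ℝ} {x K : ℝ} (hcK : ∀ m, |c m| ≤ K)
    (hu0 : u 0 = 1) (htop : Tendsto u atTop (𝓝 0)) (hbot : Tendsto u atBot (𝓝 0))
    (heq : ∀ m, (1 + c m ^ 2) * u m - c m * u (m + 1) - c (m - 1) * u (m - 1) = x * u m)
    {k : ℕ → ℕ} (hk : Tendsto k atTop atTop) (hnk : Tendsto (fun n => n - k n) atTop atTop)
    {r : ℕ → ℕ → ℝ} (hr : ∀ n t, r n t = c ((t : ℤ) - k n)) :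
    Tendsto (fun n => Metric.infDist x (spectrum ℝ (jacobiMatrix (r n) n))) atTop (𝓝 0) := by
  -- `α` and `β` are the terms of the bi-infinite equation missing from the first and last rows: the
  -- left neighbour, and the right bond together with its diagonal part.
  set α : ℕ → ℝ := fun n => c (1 - k n) * u (1 - k n) with hα
  set β : ℕ → ℝ := fun n => c (n + 1 - k n) ^ 2 * u (n + 1 - k n) -
    c (n + 1 - k n) * u (n + 1 - k n + 1) with hβ
  have hkz : Tendsto (fun n => (k n : ℤ)) atTop atTop := tendsto_natCast_atTop_atTop.comp hk
  have h1 : Tendsto (fun n => (1 - k n : ℤ)) atTop atBot := by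
    simpa [sub_eq_add_neg] using
      tendsto_atBot_add_const_left atTop (1 : ℤ) (tendsto_neg_atTop_atBot.comp hkz)
  have h2 : Tendsto (fun n : ℕ => (n + 1 - k n : ℤ)) atTop atTop := by
    refine tendsto_atTop_mono' atTop ?_ (tendsto_natCast_atTop_atTop.comp hnk)
    filter_upwards [hnk.eventually_ge_atTop 1] with n hn
    simp only [Function.comp_apply]
    omega
  have hK : 0 ≤ K := (abs_nonneg _).trans (hcK 0)
  have hα0 : Tendsto α atTop (𝓝 0) := by
    refine squeeze_zero_norm (a := fun n => K * ‖u (1 - k n)‖) (fun n => ?_) ?_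
    · rw [hα, norm_mul]
      exact mul_le_mul_of_nonneg_right (hcK _) (norm_nonneg _)
    · simpa using ((hbot.comp h1).norm.const_mul K)
  have hβ0 : Tendsto β atTop (𝓝 0) := by
    refine squeeze_zero_norm
      (a := fun n : ℕ => K ^ 2 * ‖u (n + 1 - k n)‖ + K * ‖u (n + 1 - k n + 1)‖) (fun n => ?_) ?_
    · refine (norm_sub_le _ _).trans ?_
      rw [norm_mul, norm_mul, norm_pow]
      have := hcK (n + 1 - k n)
      rw [← Real.norm_eq_abs] at this
      gcongr
    · simpa using ((htop.comp h2).norm.const_mul (K ^ 2)).add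
        ((htop.comp (tendsto_atTop_add_const_right atTop 1 h2)).norm.const_mul K)
  have hbound : ∀ᶠ n in atTop, Metric.infDist x (spectrum ℝ (jacobiMatrix (r n) n)) ≤
      √(2 * (α n ^ 2 + β n ^ 2)) := by
    filter_upwards [hk.eventually_ge_atTop 2, hnk.eventually_ge_atTop 1] with n hkn hnkn
    -- The shift by `2` makes `r (j + 2)`, the bond to the right of position `j`, equal to `c` at
    -- the site of `j`.
    set f : ℕ → ℝ := fun j => u (j + 2 - k n) with hf
    have hmain := infDist_spectrum_sq_mul_le (jacobiMatrix_isHermitian (r n) n) x (fun j => f j)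
    have hres : ∀ i : Fin n, (jacobiMatrix (r n) n *ᵥ fun j => f j) i - x * f i =
        (if (i : ℕ) = 0 then α n else 0) - if (i : ℕ) + 1 = n then β n else 0 := by
      intro i
      have hi := i.isLt
      rw [jacobiMatrix_mulVec, hf]
      simp only [hr, ← heq]
      have e1 : ((((i : ℕ) + 1 : ℕ) : ℤ) - k n) = (i : ℕ) + 2 - k n - 1 := by push_cast; ring
      have e2 : ((((i : ℕ) + 2 : ℕ) : ℤ) - k n) = (i : ℕ) + 2 - k n := by push_cast; ring
      have e3 : ((((i : ℕ) + 1 : ℕ) : ℤ) + 2 - k n) = (i : ℕ) + 2 - k n + 1 := by push_cast; ring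
      rw [e1, e2, e3]
      have hA : (if 1 ≤ (i : ℕ) then c ((i : ℕ) + 2 - k n - 1) *
          u ((((i : ℕ) - 1 : ℕ) : ℤ) + 2 - k n) else 0) =
          c ((i : ℕ) + 2 - k n - 1) * u ((i : ℕ) + 2 - k n - 1) -
            if (i : ℕ) = 0 then α n else 0 := by
        rcases Nat.eq_zero_or_pos (i : ℕ) with h0 | h0
        · have : (((i : ℕ) : ℤ) + 2 - k n - 1) = 1 - k n := by omega
          rw [if_neg (by omega), if_pos h0, hα, this]
          simp
        · have : ((((i : ℕ) - 1 : ℕ) : ℤ) + 2 - k n) = (i : ℕ) + 2 - k n - 1 := by omega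
          rw [if_pos (by omega), if_neg (by omega), this, sub_zero]
      have hB : (if (i : ℕ) + 1 < n then c ((i : ℕ) + 2 - k n) ^ 2 * u ((i : ℕ) + 2 - k n) -
          c ((i : ℕ) + 2 - k n) * u ((i : ℕ) + 2 - k n + 1) else 0) =
          c ((i : ℕ) + 2 - k n) ^ 2 * u ((i : ℕ) + 2 - k n) -
          c ((i : ℕ) + 2 - k n) * u ((i : ℕ) + 2 - k n + 1) -
            if (i : ℕ) + 1 = n then β n else 0 := by
        rcases Nat.lt_or_ge ((i : ℕ) + 1) n with h0 | h0
        · rw [if_pos h0, if_neg (by omega), sub_zero]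
        · have : (((i : ℕ) : ℤ) + 2 - k n) = n + 1 - k n := by omega
          rw [if_neg (by omega), if_pos (by omega), hβ, this]
          simp
      rw [hA, hB]
      ring
    have hsum : ∑ i : Fin n, ((jacobiMatrix (r n) n *ᵥ fun j => f j) i - x * f i) ^ 2 ≤
        2 * (α n ^ 2 + β n ^ 2) := by
      calc _ ≤ ∑ i : Fin n, ((if i = ⟨0, by omega⟩ then 2 * α n ^ 2 else 0) +
            if i = ⟨n - 1, by omega⟩ then 2 * β n ^ 2 else 0) := by
            refine Finset.sum_le_sum fun i _ => ?_
            rw [hres]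
            have e1 : (i = ⟨0, by omega⟩) ↔ (i : ℕ) = 0 := by rw [Fin.ext_iff]
            have e2 : (i = ⟨n - 1, by omega⟩) ↔ (i : ℕ) + 1 = n := by
              rw [Fin.ext_iff]
              simp only
              omega
            simp only [e1, e2]
            split_ifs <;> nlinarith [sq_nonneg (α n), sq_nonneg (β n), sq_nonneg (α n + β n)]
        _ = 2 * (α n ^ 2 + β n ^ 2) := by
            rw [Finset.sum_add_distrib]
            simp
            ring
    -- Position `k n - 2` is site `0`, where `u` equals `1`. This keeps the norm of the truncation
    -- away from zero.
    have hone : 1 ≤ ∑ i : Fin n, f i ^ 2 := by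
      have h3 := Finset.single_le_sum (f := fun i : Fin n => f i ^ 2) (fun i _ => sq_nonneg _)
        (Finset.mem_univ (⟨k n - 2, by omega⟩ : Fin n))
      have h4 : (((k n - 2 : ℕ) : ℤ) + 2 - k n) = 0 := by omega
      simpa [hf, h4, hu0] using h3
    refine Real.le_sqrt_of_sq_le ?_
    nlinarith [sq_nonneg (Metric.infDist x (spectrum ℝ (jacobiMatrix (r n) n)))]
  refine squeeze_zero' (Eventually.of_forall fun n => Metric.infDist_nonneg) hbound ?_
  have : Tendsto (fun n => √(2 * (α n ^ 2 + β n ^ 2))) atTop (𝓝 √(2 * (0 ^ 2 + 0 ^ 2))) :=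
    (((hα0.pow 2).add (hβ0.pow 2)).const_mul 2).sqrt
  simpa using this

/-! ### The limiting spectral distribution by moments. -/

lemma trace_pow_eq_sum_eigenvalues {n : ℕ} {A : Matrix (Fin n) (Fin n) ℝ} (hA : A.IsHermitian)
    (m : ℕ) : (A ^ m).trace = ∑ i, hA.eigenvalues i ^ m := by
  conv_lhs => rw [hA.spectral_theorem, ← map_pow, Unitary.conjStarAlgAut_apply,
    Matrix.trace_mul_comm, ← Matrix.mul_assoc]
  simp [diagonal_pow, Matrix.trace]

lemma integral_esd {n : ℕ} {A : Matrix (Fin n) (Fin n) ℝ} (hA : A.IsHermitian) (f : ℝ →ᵇ ℝ) :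
    ∫ x, f x ∂(esd hA) = (n : ℝ)⁻¹ * ∑ i, f (hA.eigenvalues i) := by
  rw [esd, integral_smul_measure, integral_finsetSum_measure]
  · simp
  · intro i _
    exact f.integrable _

/-- The symbol `1 + ρ² - 2 ρ cos θ` of the unperturbed Jacobi operator. -/
noncomputable def symbol (ρ θ : ℝ) : ℝ := 1 + ρ ^ 2 - 2 * ρ * Real.cos θ

lemma continuous_symbol (ρ : ℝ) : Continuous (symbol ρ) := by
  unfold symbol
  fun_prop

/-- The Fourier cosine coefficients of the powers of the symbol. -/
noncomputable def symbolCoeff (ρ : ℝ) (m : ℕ) (d : ℤ) : ℝ :=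
  Real.pi⁻¹ * ∫ θ in (0 : ℝ)..Real.pi, symbol ρ θ ^ m * Real.cos (d * θ)

lemma symbolCoeff_zero (ρ : ℝ) (d : ℤ) : symbolCoeff ρ 0 d = if d = 0 then 1 else 0 := by
  unfold symbolCoeff
  split_ifs with h
  · simp [h, Real.pi_ne_zero]
  · have hd : (d : ℝ) ≠ 0 := by exact_mod_cast h
    simp only [pow_zero, one_mul]
    rw [intervalIntegral.integral_comp_mul_left (fun x => Real.cos x) hd]
    simp [Real.sin_int_mul_pi]

/-- Since `2 cos θ cos dθ = cos (d+1)θ + cos (d-1)θ`, multiplication by the symbol acts on the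
coefficients as a row of the unperturbed Jacobi operator. This matches the induction on powers of
the matrix. -/
lemma symbolCoeff_succ (ρ : ℝ) (m : ℕ) (d : ℤ) :
    symbolCoeff ρ (m + 1) d = (1 + ρ ^ 2) * symbolCoeff ρ m d - ρ * symbolCoeff ρ m (d + 1) -
      ρ * symbolCoeff ρ m (d - 1) := by
  have hint : ∀ e : ℤ, IntervalIntegrable (fun θ => symbol ρ θ ^ m * Real.cos (e * θ)) volume 0
      Real.pi := fun e => by
    have := continuous_symbol ρ
    exact Continuous.intervalIntegrable (by fun_prop) _ _
  have h : ∀ θ : ℝ, symbol ρ θ ^ (m + 1) * Real.cos (d * θ) =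
      (1 + ρ ^ 2) * (symbol ρ θ ^ m * Real.cos (d * θ)) -
        ρ * (symbol ρ θ ^ m * Real.cos ((d + 1 : ℤ) * θ)) -
        ρ * (symbol ρ θ ^ m * Real.cos ((d - 1 : ℤ) * θ)) := by
    intro θ
    have e1 : ((d + 1 : ℤ) : ℝ) * θ = d * θ + θ := by push_cast; ring
    have e2 : ((d - 1 : ℤ) : ℝ) * θ = d * θ - θ := by push_cast; ring
    rw [e1, e2, Real.cos_add, Real.cos_sub, pow_succ]
    conv_lhs => rw [show symbol ρ θ ^ m * symbol ρ θ =
      symbol ρ θ ^ m * (1 + ρ ^ 2 - 2 * ρ * Real.cos θ) from rfl]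
    ring
  unfold symbolCoeff
  simp only [h]
  rw [intervalIntegral.integral_sub (((hint _).const_mul _).sub ((hint _).const_mul _))
    ((hint _).const_mul _), intervalIntegral.integral_sub ((hint _).const_mul _)
    ((hint _).const_mul _)]
  simp only [intervalIntegral.integral_const_mul]
  ring

/-- Extension by zero of a vector to the natural numbers. -/
noncomputable def extendZero {n : ℕ} (v : Fin n → ℝ) (l : ℕ) : ℝ := if h : l < n then v ⟨l, h⟩ else 0

lemma extendZero_of_lt {n : ℕ} (v : Fin n → ℝ) {l : ℕ} (h : l < n) :
    extendZero v l = v ⟨l, h⟩ := dif_pos h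

lemma extendZero_coe {n : ℕ} (v : Fin n → ℝ) : (fun j : Fin n => extendZero v j) = v := by
  funext j
  rw [extendZero_of_lt v j.isLt]

/-- Away from the break and from the boundary the powers of the Jacobi matrix agree with those of
the Laurent operator. -/
lemma jacobiMatrix_pow_apply {ρ : ℝ} {r : ℕ → ℝ} {n : ℕ} (m : ℕ) (i : Fin n) (h1 : m ≤ (i : ℕ))
    (h2 : (i : ℕ) + m + 1 ≤ n)
    (h3 : ∀ t, (i : ℕ) + 1 ≤ t + m → t ≤ (i : ℕ) + m + 2 → r t = ρ) (j : Fin n) :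
    (jacobiMatrix r n ^ m) i j = symbolCoeff ρ m ((i : ℤ) - j) := by
  induction m generalizing i with
  | zero =>
    rw [pow_zero, one_apply, symbolCoeff_zero]
    have : i = j ↔ (i : ℤ) - j = 0 := by rw [Fin.ext_iff]; omega
    simp only [this]
  | succ m ih =>
    -- Each further factor reaches only the neighbouring rows, so the break-free window needed
    -- around `i` widens by one on each side.
    have hcol : (jacobiMatrix r n ^ (m + 1)) i j = (jacobiMatrix r n *ᵥ fun l =>
        extendZero (fun a => (jacobiMatrix r n ^ m) a j) l) i := by
      rw [extendZero_coe, pow_succ', mul_apply]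
      rfl
    have hi := i.isLt
    rw [hcol, jacobiMatrix_mulVec, if_pos (by omega), if_pos (by omega),
      extendZero_of_lt _ (show (i : ℕ) < n by omega),
      extendZero_of_lt _ (show (i : ℕ) - 1 < n by omega),
      extendZero_of_lt _ (show (i : ℕ) + 1 < n by omega),
      ih ⟨i, by omega⟩ (by simp; omega) (by simp; omega)
        (fun t _ _ => h3 t (by simp_all; omega) (by simp_all; omega)),
      ih ⟨i - 1, by omega⟩ (by simp; omega) (by simp; omega)
        (fun t _ _ => h3 t (by simp_all; omega) (by simp_all; omega)),
      ih ⟨i + 1, by omega⟩ (by simp; omega) (by simp; omega)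
        (fun t _ _ => h3 t (by simp_all; omega) (by simp_all; omega)),
      h3 (i + 1) (by omega) (by omega), h3 (i + 2) (by omega) (by omega), symbolCoeff_succ]
    have e1 : ((((i : ℕ) - 1 : ℕ) : ℤ) - j) = (i : ℤ) - j - 1 := by omega
    have e2 : ((((i : ℕ) + 1 : ℕ) : ℤ) - j) = (i : ℤ) - j + 1 := by omega
    simp only [e1, e2]
    ring

/-- Absolute row sums are at most `1 + 2κ + κ²`, uniformly in `n`. -/
lemma abs_jacobiMatrix_mulVec_le {r : ℕ → ℝ} {κ : ℝ} (hr : ∀ t, |r t| ≤ κ) {n : ℕ}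
    {v : Fin n → ℝ} {S : ℝ} (hS : 0 ≤ S) (hv : ∀ j, |v j| ≤ S) (i : Fin n) :
    |(jacobiMatrix r n *ᵥ v) i| ≤ (1 + κ) ^ 2 * S := by
  have hκ : 0 ≤ κ := (abs_nonneg _).trans (hr 0)
  have hf : ∀ l, |extendZero v l| ≤ S := by
    intro l
    unfold extendZero
    split_ifs
    · exact hv _
    · simpa using hS
  conv_lhs => rw [← extendZero_coe v]
  rw [jacobiMatrix_mulVec]
  set f := extendZero v
  have hb : ∀ t l, |r t * f l| ≤ κ * S := fun t l => by
    rw [abs_mul]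
    exact mul_le_mul (hr _) (hf _) (abs_nonneg _) hκ
  have h1 : |if 1 ≤ (i : ℕ) then r (i + 1) * f (i - 1) else 0| ≤ κ * S := by
    split_ifs
    · exact hb _ _
    · simpa using mul_nonneg hκ hS
  have h2 : |if (i : ℕ) + 1 < n then r (i + 2) ^ 2 * f i - r (i + 2) * f (i + 1) else 0| ≤
      κ ^ 2 * S + κ * S := by
    split_ifs
    · refine (abs_sub _ _).trans (add_le_add ?_ (hb _ _))
      rw [abs_mul, abs_pow]
      exact mul_le_mul (pow_le_pow_left₀ (abs_nonneg _) (hr _) 2) (hf _) (abs_nonneg _)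
        (by positivity)
    · simpa using by positivity
  calc _ ≤ S + κ * S + (κ ^ 2 * S + κ * S) :=
        (abs_add_le _ _).trans (add_le_add ((abs_sub _ _).trans (add_le_add (hf _) h1)) h2)
    _ = _ := by ring

lemma abs_jacobiMatrix_pow_le {r : ℕ → ℝ} {κ : ℝ} (hr : ∀ t, |r t| ≤ κ) {n : ℕ} (m : ℕ)
    (i j : Fin n) : |(jacobiMatrix r n ^ m) i j| ≤ ((1 + κ) ^ 2) ^ m := by
  induction m generalizing i with
  | zero =>
    rw [pow_zero, one_apply]
    split_ifs <;> simp
  | succ m ih =>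
    rw [pow_succ', mul_apply, pow_succ']
    exact abs_jacobiMatrix_mulVec_le hr (by positivity) ih i

/-- The row-sum bound is applied at a coordinate where the eigenvector is largest in modulus. -/
lemma abs_eigenvalues_jacobiMatrix_le {r : ℕ → ℝ} {κ : ℝ} (hr : ∀ t, |r t| ≤ κ) {n : ℕ}
    (i : Fin n) : |(jacobiMatrix_isHermitian r n).eigenvalues i| ≤ (1 + κ) ^ 2 := by
  set hA := jacobiMatrix_isHermitian r n
  set v : Fin n → ℝ := ⇑(hA.eigenvectorBasis i) with hv
  obtain ⟨a, -, ha⟩ := Finset.exists_max_image Finset.univ (fun j => |v j|) ⟨i, Finset.mem_univ _⟩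
  have h1 := abs_jacobiMatrix_mulVec_le hr (abs_nonneg (v a)) (fun j => ha j (Finset.mem_univ _)) a
  rw [hv, hA.mulVec_eigenvectorBasis, Pi.smul_apply, smul_eq_mul, abs_mul] at h1
  refine le_of_mul_le_mul_right h1 ?_
  rw [abs_pos]
  intro h0
  refine hA.eigenvectorBasis.orthonormal.ne_zero i ?_
  ext j
  have := ha j (Finset.mem_univ _)
  rw [hv] at this
  rw [h0, abs_zero] at this
  simpa using abs_nonpos_iff.mp this

lemma tendsto_trace_pow_jacobiMatrix {ρ κ : ℝ} {r : ℕ → ℕ → ℝ} {k : ℕ → ℕ} {h : ℕ}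
    (hr : ∀ n t, |r n t| ≤ κ) (hρ : ∀ n t, t < k n ∨ k n + h ≤ t → r n t = ρ) (m : ℕ) :
    Tendsto (fun n : ℕ => (n : ℝ)⁻¹ * (jacobiMatrix (r n) n ^ m).trace) atTop
      (𝓝 (symbolCoeff ρ m 0)) := by
  set M := symbolCoeff ρ m 0 with hM
  set C : ℝ := ((1 + κ) ^ 2) ^ m + |M| with hC
  have hC0 : 0 ≤ C := by positivity
  have hbound : ∀ n : ℕ, |(jacobiMatrix (r n) n ^ m).trace - n * M| ≤
      (m + m + (h + 2 * m + 2) : ℕ) * C := by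
    intro n
    -- Exceptional positions: those too close to an end or to the break. Their number is bounded
    -- independently of `n`, so they disappear after division by `n`.
    set S : Finset ℕ := Finset.range m ∪ Finset.Ico (n - m) n ∪
      Finset.Ico (k n - (m + 2)) (k n + h + m) with hS
    have hcard : S.card ≤ m + m + (h + 2 * m + 2) := by
      refine (Finset.card_union_le _ _).trans (add_le_add
        ((Finset.card_union_le _ _).trans (add_le_add ?_ ?_)) ?_)
      · simp
      · rw [Nat.card_Ico]
        omega
      · rw [Nat.card_Ico]
        omega
    have hterm : ∀ i : Fin n, |(jacobiMatrix (r n) n ^ m) i i - M| ≤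
        if (i : ℕ) ∈ S then C else 0 := by
      intro i
      split_ifs with hi
      · exact (abs_sub _ _).trans (add_le_add (abs_jacobiMatrix_pow_le (hr n) m i i) le_rfl)
      · simp only [hS, Finset.mem_union, Finset.mem_range, Finset.mem_Ico] at hi
        have := i.isLt
        rw [jacobiMatrix_pow_apply (ρ := ρ) m i (by omega) (by omega)
          (fun t h1 h2 => hρ n t (by omega))]
        simp [hM]
    calc |(jacobiMatrix (r n) n ^ m).trace - n * M|
        = |∑ i : Fin n, ((jacobiMatrix (r n) n ^ m) i i - M)| := by
          simp [Matrix.trace, Finset.sum_sub_distrib]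
      _ ≤ ∑ i : Fin n, (fun i : ℕ => if i ∈ S then C else 0) i :=
          (Finset.abs_sum_le_sum_abs _ _).trans (Finset.sum_le_sum fun i _ => hterm i)
      _ = (Finset.range n ∩ S).card * C := by
          rw [Fin.sum_univ_eq_sum_range (fun i : ℕ => if i ∈ S then C else 0), Finset.sum_ite_mem, Finset.sum_const, nsmul_eq_mul]
      _ ≤ _ := by
          gcongr
          exact (Finset.card_le_card Finset.inter_subset_right).trans hcard
  rw [tendsto_iff_norm_sub_tendsto_zero]
  refine squeeze_zero' (g := fun n : ℕ => (m + m + (h + 2 * m + 2) : ℕ) * C * (n : ℝ)⁻¹)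
    (Eventually.of_forall fun n => norm_nonneg _) ?_ ?_
  · filter_upwards [eventually_gt_atTop 0] with n hn
    have hn' : (0 : ℝ) < n := by exact_mod_cast hn
    have : (n : ℝ)⁻¹ * (jacobiMatrix (r n) n ^ m).trace - M =
        (n : ℝ)⁻¹ * ((jacobiMatrix (r n) n ^ m).trace - n * M) := by
      field_simp
    rw [this, norm_mul, Real.norm_eq_abs, Real.norm_eq_abs, abs_of_pos (inv_pos.mpr hn'), mul_comm]
    exact mul_le_mul_of_nonneg_right (hbound n) (inv_pos.mpr hn').le
  · simpa using (tendsto_inv_atTop_nhds_zero_nat (𝕜 := ℝ)).const_mul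
      (((m + m + (h + 2 * m + 2) : ℕ) : ℝ) * C)

/-- The law of `1 + ρ² - 2 ρ cos θ` for `θ` uniform on `[0, π]`. -/
noncomputable def symbolLaw (ρ : ℝ) : Measure ℝ :=
  (ENNReal.ofReal Real.pi⁻¹ • volume.restrict (Set.Ioc 0 Real.pi)).map (symbol ρ)

instance (ρ : ℝ) : IsProbabilityMeasure (symbolLaw ρ) := by
  have : IsProbabilityMeasure
      (ENNReal.ofReal Real.pi⁻¹ • (volume : Measure ℝ).restrict (Set.Ioc 0 Real.pi)) := by
    refine ⟨?_⟩
    simp only [Measure.smul_apply, Measure.restrict_apply_univ, Real.volume_Ioc, smul_eq_mul,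
      sub_zero]
    rw [← ENNReal.ofReal_mul (by positivity), inv_mul_cancel₀ Real.pi_ne_zero, ENNReal.ofReal_one]
  exact Measure.isProbabilityMeasure_map (continuous_symbol ρ).aemeasurable

lemma integral_symbolLaw (ρ : ℝ) {f : ℝ → ℝ} (hf : Continuous f) :
    ∫ x, f x ∂(symbolLaw ρ) = Real.pi⁻¹ * ∫ θ in (0 : ℝ)..Real.pi, f (symbol ρ θ) := by
  rw [symbolLaw, integral_map (continuous_symbol ρ).aemeasurable hf.aestronglyMeasurable,
    integral_smul_measure, intervalIntegral.integral_of_le Real.pi_pos.le,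
    ENNReal.toReal_ofReal (by positivity), smul_eq_mul]

lemma symbol_mem_Icc (ρ θ : ℝ) : symbol ρ θ ∈ Set.Icc (aBound ρ) (bBound ρ) := by
  have h : |ρ * Real.cos θ| ≤ |ρ| := by
    rw [abs_mul]
    exact mul_le_of_le_one_right (abs_nonneg _) (Real.abs_cos_le_one θ)
  rw [abs_le] at h
  have h2 := sq_abs ρ
  constructor <;> simp only [symbol, aBound, bBound] <;> nlinarith

lemma integrable_symbolLaw (ρ : ℝ) {f : ℝ → ℝ} (hf : Continuous f) :
    Integrable f (symbolLaw ρ) := by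
  rw [symbolLaw, integrable_map_measure hf.aestronglyMeasurable (continuous_symbol ρ).aemeasurable]
  refine Integrable.smul_measure ?_ ENNReal.ofReal_ne_top
  exact ((hf.comp (continuous_symbol ρ)).continuousOn.integrableOn_Icc).mono_set
    Set.Ioc_subset_Icc_self

lemma ae_symbolLaw (ρ : ℝ) : ∀ᵐ x ∂(symbolLaw ρ), x ∈ Set.Icc (aBound ρ) (bBound ρ) := by
  rw [symbolLaw, ae_map_iff (p := (· ∈ Set.Icc (aBound ρ) (bBound ρ)))
    (continuous_symbol ρ).aemeasurable measurableSet_Icc]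
  exact Eventually.of_forall fun θ => symbol_mem_Icc ρ θ

lemma exists_symbol_eq {ρ x : ℝ} (hx : x ∈ Set.Icc (aBound ρ) (bBound ρ)) :
    ∃ θ ∈ Set.Icc 0 Real.pi, symbol ρ θ = x := by
  have hc := (continuous_symbol ρ).continuousOn (s := Set.Icc 0 Real.pi)
  have h0 : symbol ρ 0 = (1 - ρ) ^ 2 := by simp [symbol]; ring
  have h1 : symbol ρ Real.pi = (1 + ρ) ^ 2 := by simp [symbol]; ring
  rcases le_total 0 ρ with h | h
  · have := intermediate_value_Icc Real.pi_pos.le hc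
    rw [h0, h1] at this
    rw [aBound, bBound, abs_of_nonneg h] at hx
    exact this hx
  · have := intermediate_value_Icc' Real.pi_pos.le hc
    rw [h0, h1] at this
    rw [aBound, bBound, abs_of_nonpos h, sub_neg_eq_add, ← sub_eq_add_neg] at hx
    exact this hx

/-- Every point of the band is a value of the symbol, and the preimage of a neighbourhood contains a
nonempty open subset of `(0, π)`, which has positive length. -/
lemma support_symbolLaw (ρ : ℝ) : (symbolLaw ρ).support = Set.Icc (aBound ρ) (bBound ρ) := by
  refine Set.Subset.antisymm
    (Measure.support_subset_of_isClosed isClosed_Icc (ae_symbolLaw ρ)) fun x hx => ?_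
  rw [Measure.mem_support_iff_forall]
  intro U hU
  obtain ⟨V, hVU, hV, hxV⟩ := mem_nhds_iff.mp hU
  refine lt_of_lt_of_le ?_ (measure_mono hVU)
  obtain ⟨θ, hθ, rfl⟩ := exists_symbol_eq hx
  rw [symbolLaw, Measure.map_apply (continuous_symbol ρ).measurable hV.measurableSet,
    Measure.smul_apply, smul_eq_mul]
  refine ENNReal.mul_pos (by simpa using Real.pi_pos) ?_
  rw [Measure.restrict_apply ((continuous_symbol ρ).measurable hV.measurableSet)]
  have hopen : IsOpen (symbol ρ ⁻¹' V ∩ Set.Ioo 0 Real.pi) :=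
    (hV.preimage (continuous_symbol ρ)).inter isOpen_Ioo
  have hne : (symbol ρ ⁻¹' V ∩ Set.Ioo 0 Real.pi).Nonempty := by
    have hcl : θ ∈ closure (Set.Ioo 0 Real.pi) := by
      rwa [closure_Ioo Real.pi_pos.ne]
    exact mem_closure_iff.mp hcl _ (hV.preimage (continuous_symbol ρ)) hxV
  exact (lt_of_lt_of_le (hopen.measure_pos volume hne)
    (measure_mono (Set.inter_subset_inter_right _ Set.Ioo_subset_Ioc_self))).ne'

/-- The empirical spectral distributions of Jacobi matrices with a local break converge weakly. -/
lemma isASD_jacobiMatrix {ρ κ : ℝ} {r : ℕ → ℕ → ℝ} {k : ℕ → ℕ} {h : ℕ}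
    (hr : ∀ n t, |r n t| ≤ κ) (hρ : ∀ n t, t < k n ∨ k n + h ≤ t → r n t = ρ) (hρκ : |ρ| ≤ κ) :
    IsASD (fun n => jacobiMatrix (r n) n) (symbolLaw ρ) := by
  refine ⟨inferInstance, ?_, fun n => jacobiMatrix_isHermitian (r n) n, fun f => ?_⟩
  · rw [support_symbolLaw]
    exact isCompact_Icc
  set lam : ∀ n, Fin n → ℝ := fun n => (jacobiMatrix_isHermitian (r n) n).eigenvalues with hlam
  have hmono : ∀ m : ℕ, Tendsto (fun n : ℕ => (n : ℝ)⁻¹ * ∑ i, lam n i ^ m) atTop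
      (𝓝 (∫ x, x ^ m ∂(symbolLaw ρ))) := by
    intro m
    have h1 := tendsto_trace_pow_jacobiMatrix hr hρ m
    simp only [trace_pow_eq_sum_eigenvalues (jacobiMatrix_isHermitian _ _)] at h1
    convert h1 using 2
    rw [integral_symbolLaw ρ (by fun_prop), symbolCoeff]
    simp
  have hpoly : ∀ p : Polynomial ℝ, Tendsto (fun n : ℕ => (n : ℝ)⁻¹ * ∑ i, p.eval (lam n i)) atTop
      (𝓝 (∫ x, p.eval x ∂(symbolLaw ρ))) := by
    intro p
    induction p using Polynomial.induction_on' with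
    | add p q hp hq =>
      simp only [Polynomial.eval_add, Finset.sum_add_distrib, mul_add]
      rw [integral_add (integrable_symbolLaw ρ p.continuous) (integrable_symbolLaw ρ q.continuous)]
      exact hp.add hq
    | monomial m a =>
      simp only [Polynomial.eval_monomial, ← Finset.mul_sum, integral_const_mul]
      convert (hmono m).const_mul a using 2
      ring
  -- `[-R, R]` contains all the eigenvalues for every `n` as well as the band, so a single
  -- Weierstrass polynomial approximates `f` on all of them.
  set R : ℝ := (1 + κ) ^ 2 with hR
  have hκ : 0 ≤ κ := (abs_nonneg _).trans hρκ
  rw [Metric.tendsto_atTop']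
  intro δ hδ
  obtain ⟨p, hp⟩ := exists_polynomial_near_of_continuousOn (-R) R f f.continuous.continuousOn
    (δ / 3) (by positivity)
  obtain ⟨N, hN⟩ := Metric.tendsto_atTop'.mp (hpoly p) (δ / 3) (by positivity)
  refine ⟨N, fun n hn => ?_⟩
  have hn0 : (0 : ℝ) < n := by exact_mod_cast (Nat.zero_le N).trans_lt hn
  have h1 := hN n hn
  have h2 : |(n : ℝ)⁻¹ * ∑ i, p.eval (lam n i) - (n : ℝ)⁻¹ * ∑ i, f (lam n i)| ≤ δ / 3 := by
    rw [← mul_sub, ← Finset.sum_sub_distrib, abs_mul, abs_of_pos (inv_pos.mpr hn0)]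
    calc _ ≤ (n : ℝ)⁻¹ * ∑ i : Fin n, (δ / 3) := by
          gcongr
          refine (Finset.abs_sum_le_sum_abs _ _).trans (Finset.sum_le_sum fun i _ => ?_)
          exact (hp _ (abs_le.mp (abs_eigenvalues_jacobiMatrix_le (hr n) i))).le
      _ = δ / 3 := by
          rw [Finset.sum_const, Finset.card_univ, Fintype.card_fin, nsmul_eq_mul]
          field_simp
  have h3 : |∫ x, p.eval x ∂(symbolLaw ρ) - ∫ x, f x ∂(symbolLaw ρ)| ≤ δ / 3 := by
    rw [← integral_sub (integrable_symbolLaw ρ p.continuous)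
      (integrable_symbolLaw ρ f.continuous), ← Real.norm_eq_abs]
    refine (norm_integral_le_of_norm_le_const (C := δ / 3) ?_).trans (by simp)
    filter_upwards [ae_symbolLaw ρ] with x hx
    refine (hp x ⟨?_, ?_⟩).le
    · have : 0 ≤ aBound ρ := sq_nonneg _
      have := hx.1
      have : 0 ≤ R := sq_nonneg _
      linarith
    · refine hx.2.trans ?_
      rw [bBound, hR]
      gcongr
  rw [integral_esd, Real.dist_eq]
  rw [Real.dist_eq] at h1
  rw [abs_le] at h2 h3
  rw [abs_lt] at h1 ⊢
  constructor <;> simp only [hlam] at * <;> linarith [h1.1, h1.2, h2.1, h2.2, h3.1, h3.2]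

end SCM

/-! ### Bound states of the bi-infinite operator. -/

namespace SCM
open Polynomial.Chebyshev

/-- Evaluation of the Chebyshev polynomials of the second kind. -/
noncomputable def chebU (m : ℤ) (c : ℝ) : ℝ := (U ℝ m).eval c

lemma chebU_add_one (m : ℤ) (c : ℝ) : chebU (m + 1) c = 2 * c * chebU m c - chebU (m - 1) c := by
  simp [chebU, U_add_one]

lemma chebU_zero (c : ℝ) : chebU 0 c = 1 := by simp [chebU]

lemma chebU_neg_one (c : ℝ) : chebU (-1) c = 0 := by simp [chebU]

lemma continuous_chebU (m : ℤ) : Continuous (chebU m) := (U ℝ m).continuous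

lemma tendsto_zpow_atTop_zero {R : ℝ} (hR : |R| < 1) :
    Tendsto (fun m : ℤ => R ^ m) atTop (𝓝 0) := by
  have h1 : Tendsto Int.toNat atTop atTop :=
    tendsto_atTop_atTop.mpr fun b => ⟨b, fun a ha => by omega⟩
  refine ((tendsto_pow_atTop_nhds_zero_of_abs_lt_one hR).comp h1).congr' ?_
  filter_upwards [eventually_ge_atTop 0] with m hm
  rw [Function.comp_apply, ← zpow_natCast, Int.toNat_of_nonneg hm]

/-- The coupling constants of the bi-infinite Jacobi operator with a break of length `h`. -/
noncomputable def coupling (ρ σ : ℝ) (h : ℕ) (m : ℤ) : ℝ := if 0 ≤ m ∧ m < h then σ else ρ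

/-- The secular function whose zeros yield bound states; `R` and `R'` stand for the decaying
solution multiplier and its inverse. -/
noncomputable def secular (ρ σ R R' c : ℝ) (h : ℕ) : ℝ :=
  ρ * R' * chebU h c - (ρ ^ 2 / σ + σ) * chebU (h - 1) c + ρ * R * chebU (h - 2) c

lemma exists_boundState {ρ σ R R' c x : ℝ} {h : ℕ} (hh : 1 ≤ h) (hσ : σ ≠ 0) (hRR : R * R' = 1)
    (hR1 : |R| < 1) (hx : ρ * (R + R') = 1 + ρ ^ 2 - x) (hc : 2 * σ * c = 1 + σ ^ 2 - x)
    (hF : secular ρ σ R R' c h = 0) :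
    ∃ u : ℤ → ℝ, u 0 = 1 ∧ Tendsto u atTop (𝓝 0) ∧ Tendsto u atBot (𝓝 0) ∧
      ∀ m, (1 + coupling ρ σ h m ^ 2) * u m - coupling ρ σ h m * u (m + 1) -
        coupling ρ σ h (m - 1) * u (m - 1) = x * u m := by
  have hR0 : R ≠ 0 := left_ne_zero_of_mul_eq_one hRR
  obtain rfl : R' = R⁻¹ := eq_inv_of_mul_eq_one_right hRR
  -- The solution on the break, normalised by `V 0 = 1`; the coefficient of `U_{m-1}` makes the
  -- equation hold at site `0`, with `R` as left neighbour.
  set V : ℤ → ℝ := fun m => chebU m c - ρ * R / σ * chebU (m - 1) c with hV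
  have hV0 : V 0 = 1 := by simp [hV, chebU_zero, chebU_neg_one]
  have hVrec : ∀ m, σ * V (m + 1) = 2 * σ * c * V m - σ * V (m - 1) := by
    intro m
    have h1 := chebU_add_one m c
    have h2 := chebU_add_one (m - 1) c
    rw [sub_add_cancel] at h2
    simp only [hV]
    rw [add_sub_cancel_right, h1]
    conv_lhs => rw [h2]
    conv_rhs => rw [h2]
    ring
  have hV1 : σ * V 1 = 2 * σ * c - ρ * R := by
    have h1 := chebU_add_one 0 c
    simp only [hV]
    rw [zero_add] at h1
    rw [h1, sub_self, chebU_zero, zero_sub, chebU_neg_one]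
    field_simp
    ring
  -- The equation at site `h`, the only condition left; it is exactly the vanishing of the secular
  -- function.
  have hVh : σ * V (h - 1) = ρ * V h * R⁻¹ := by
    rw [secular] at hF
    simp only [hV, show (h : ℤ) - 1 - 1 = h - 2 by ring]
    have h1 : ρ * (chebU h c - ρ * R / σ * chebU (h - 1) c) * R⁻¹ =
        ρ * R⁻¹ * chebU h c - ρ ^ 2 / σ * chebU (h - 1) c := by
      field_simp
    have h2 : σ * (chebU (h - 1) c - ρ * R / σ * chebU (h - 2) c) =
        σ * chebU (h - 1) c - ρ * R * chebU (h - 2) c := by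
      field_simp
    rw [h1, h2]
    linarith
  set u : ℤ → ℝ := fun m =>
    if m ≤ 0 then R ^ (-m) else if m ≤ h then V m else V h * R ^ (m - h) with hu
  have hu1 : ∀ m ≤ 0, u m = R ^ (-m) := fun m hm => if_pos hm
  have hu2 : ∀ m : ℤ, 0 ≤ m → m ≤ h → u m = V m := by
    intro m h0 h1
    rcases h0.eq_or_lt with rfl | h0
    · simp [hu, hV0]
    · simp [hu, h0.not_ge, h1]
  have hu3 : ∀ m : ℤ, (h : ℤ) ≤ m → u m = V h * R ^ (m - h) := by
    intro m h1
    rcases h1.eq_or_lt with rfl | h1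
    · rw [hu2 h (by omega) le_rfl]
      simp
    · simp [hu, show ¬ m ≤ 0 by omega, h1.not_ge]
  have hout : ∀ m : ℤ, m < 0 ∨ (h : ℤ) ≤ m → coupling ρ σ h m = ρ := fun m hm =>
    if_neg (by omega)
  have hin : ∀ m : ℤ, 0 ≤ m → m < h → coupling ρ σ h m = σ := fun m h0 h1 => if_pos ⟨h0, h1⟩
  refine ⟨u, by simp [hu], ?_, ?_, fun m => ?_⟩
  · have h1 : Tendsto (fun m : ℤ => V h * R ^ (m - h)) atTop (𝓝 0) := by
      simpa [sub_eq_add_neg] using ((tendsto_zpow_atTop_zero hR1).comp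
        (tendsto_atTop_add_const_right atTop (-(h : ℤ)) tendsto_id)).const_mul (V h)
    refine h1.congr' ?_
    filter_upwards [eventually_ge_atTop (h : ℤ)] with m hm
    exact (hu3 m hm).symm
  · refine ((tendsto_zpow_atTop_zero hR1).comp tendsto_neg_atBot_atTop).congr' ?_
    filter_upwards [eventually_le_atBot (0 : ℤ)] with m hm
    exact (hu1 m hm).symm
  · rcases lt_trichotomy m 0 with hm | rfl | hm
    · rw [hout m (by omega), hout (m - 1) (by omega), hu1 m (by omega), hu1 (m + 1) (by omega),
        hu1 (m - 1) (by omega), show -(m + 1) = -m - 1 by ring, show -(m - 1) = -m + 1 by ring,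
        zpow_sub_one₀ hR0, zpow_add_one₀ hR0]
      linear_combination (-R ^ (-m)) * hx
    · rw [hin 0 le_rfl (by omega), hout (0 - 1) (by omega), zero_add, hu2 0 le_rfl (by omega),
        hu2 1 (by omega) (by omega), hu1 (0 - 1) (by omega), hV0]
      norm_num
      linear_combination -hV1 - hc
    rcases lt_trichotomy m h with hm' | rfl | hm'
    · rw [hin m (by omega) (by omega), hin (m - 1) (by omega) (by omega),
        hu2 m (by omega) (by omega), hu2 (m + 1) (by omega) (by omega),
        hu2 (m - 1) (by omega) (by omega)]
      linear_combination -hVrec m - V m * hc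
    · rw [hout h (by omega), hin (h - 1) (by omega) (by omega), hu2 h (by omega) (by omega),
        hu3 (h + 1) (by omega), hu2 (h - 1) (by omega) (by omega)]
      simp only [add_sub_cancel_left, zpow_one]
      linear_combination -hVh - V h * hx
    · rw [hout m (by omega), hout (m - 1) (by omega), hu3 m (by omega), hu3 (m + 1) (by omega),
        hu3 (m - 1) (by omega), show m + 1 - h = m - h + 1 by ring,
        show m - 1 - h = m - h - 1 by ring, zpow_sub_one₀ hR0, zpow_add_one₀ hR0]
      linear_combination (-(V h * R ^ (m - h))) * hx

end SCM

/-! ### Signs of Chebyshev polynomials and of the secular function. -/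

namespace SCM
open Polynomial.Chebyshev

lemma chebU_neg (n : ℕ) (c : ℝ) :
    chebU n (-c) = (-1) ^ n * chebU n c ∧ chebU (n - 1) (-c) = -((-1) ^ n * chebU (n - 1) c) := by
  induction n with
  | zero => simp [chebU_zero, chebU_neg_one]
  | succ n ih =>
    have e : (((n + 1 : ℕ) : ℤ)) - 1 = n := by push_cast; ring
    rw [e]
    push_cast
    rw [chebU_add_one, chebU_add_one, ih.1, ih.2]
    constructor <;> ring

/-- `U_{n+1} - U_n = (2c - 2) U_n + (U_n - U_{n-1})`, and both terms are nonnegative by induction.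
-/
lemma chebU_pos {c : ℝ} (hc : 1 ≤ c) (n : ℕ) :
    0 < chebU n c ∧ chebU (n - 1) c ≤ chebU n c := by
  induction n with
  | zero => simp [chebU_zero, chebU_neg_one]
  | succ n ih =>
    have e : (((n + 1 : ℕ) : ℤ)) - 1 = n := by push_cast; ring
    rw [e]
    push_cast
    rw [chebU_add_one]
    constructor <;> nlinarith [ih.1, ih.2]

/-- At this argument the recurrence has characteristic roots `τ` and `τ⁻¹`, and the combination
removes the first. It serves at `x = 0`, where `c` takes this form. -/
lemma chebU_sub_mul {τ : ℝ} (hτ : τ ≠ 0) (n : ℕ) :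
    chebU n ((τ + τ⁻¹) / 2) - τ * chebU (n - 1) ((τ + τ⁻¹) / 2) = τ⁻¹ ^ n := by
  induction n with
  | zero => simp [chebU_zero, chebU_neg_one]
  | succ n ih =>
    have e : (((n + 1 : ℕ) : ℤ)) - 1 = n := by push_cast; ring
    rw [e, pow_succ, ← ih]
    push_cast
    rw [chebU_add_one]
    field_simp
    ring

/-- The sign of a Chebyshev polynomial of the second kind between consecutive zeros. -/
lemma chebU_sign {h j : ℕ} (hj : j < h) {c : ℝ}
    (h1 : Real.cos ((j + 1 : ℕ) * Real.pi / h) < c)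
    (h2 : j = 0 ∨ c < Real.cos (j * Real.pi / h)) :
    0 < (-1) ^ j * chebU (h - 1) c := by
  have hh : (0 : ℝ) < h := by exact_mod_cast (Nat.zero_le j).trans_lt hj
  have hpi := Real.pi_pos
  rcases lt_or_ge c 1 with hc | hc
  · have hc' : -1 < c := lt_of_le_of_lt (Real.neg_one_le_cos _) h1
    set θ := Real.arccos c with hθ
    have hcos : Real.cos θ = c := Real.cos_arccos hc'.le hc.le
    have hθ0 : 0 < θ := Real.arccos_pos.mpr hc
    have hθpi : θ < Real.pi := lt_of_le_of_ne (Real.arccos_le_pi c) fun h => by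
      rw [h, Real.cos_pi] at hcos
      exact hc'.ne hcos
    have hj1 : ((j + 1 : ℕ) : ℝ) ≤ h := by exact_mod_cast hj
    have hmem : ∀ m : ℝ, 0 ≤ m → m ≤ h → m * Real.pi / h ∈ Set.Icc 0 Real.pi := fun m h0 h1 => by
      refine ⟨by positivity, ?_⟩
      rw [div_le_iff₀ hh, mul_comm Real.pi]
      gcongr
    rw [← hcos] at h1 h2 ⊢
    have h1' : θ < (j + 1 : ℕ) * Real.pi / h :=
      (Real.strictAntiOn_cos.lt_iff_gt (hmem _ (by positivity) hj1) ⟨hθ0.le, hθpi.le⟩).mp h1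
    have h2' : j * Real.pi / h < θ := by
      rcases h2 with rfl | h2
      · simpa using hθ0
      · refine (Real.strictAntiOn_cos.lt_iff_gt ⟨hθ0.le, hθpi.le⟩
          (hmem _ (by positivity) (by exact_mod_cast hj.le))).mp h2
    -- `U_{h-1}(cos θ) sin θ = sin hθ`, and `hθ` lies in `(jπ, (j+1)π)`.
    have hU : chebU (h - 1) (Real.cos θ) * Real.sin θ = Real.sin (h * θ) := by
      have := U_real_cos θ (h - 1)
      simpa only [chebU, Int.cast_sub, Int.cast_natCast, Int.cast_one, sub_add_cancel] using this
    have hs : 0 < Real.sin θ := Real.sin_pos_of_pos_of_lt_pi hθ0 hθpi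
    have hsin : 0 < (-1) ^ j * Real.sin (h * θ) := by
      rw [← Real.sin_sub_nat_mul_pi]
      rw [lt_div_iff₀ hh] at h1'
      rw [div_lt_iff₀ hh] at h2'
      push_cast at h1'
      exact Real.sin_pos_of_pos_of_lt_pi (by linarith) (by linarith)
    rw [← hU, ← mul_assoc] at hsin
    exact pos_of_mul_pos_left hsin hs.le
  · have hj0 : j = 0 := h2.resolve_right fun h => absurd (h.trans_le (Real.cos_le_one _)) hc.not_gt
    obtain ⟨n, rfl⟩ : ∃ n, h = n + 1 := ⟨h - 1, by omega⟩
    have e : (((n + 1 : ℕ) : ℤ)) - 1 = n := by push_cast; ring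
    rw [hj0, e]
    simpa using (chebU_pos hc n).1

lemma chebU_at_node {h j : ℕ} (hj0 : 0 < j) (hj : j < h) :
    chebU (h - 1) (Real.cos (j * Real.pi / h)) = 0 ∧
      chebU h (Real.cos (j * Real.pi / h)) = (-1) ^ j := by
  have hh : (0 : ℝ) < h := by exact_mod_cast hj0.trans hj
  have hj' : (j : ℝ) < h := by exact_mod_cast hj
  have hj0' : (0 : ℝ) < j := by exact_mod_cast hj0
  set θ := j * Real.pi / h with hθ
  have hhθ : h * θ = j * Real.pi := by rw [hθ]; field_simp
  have hs : 0 < Real.sin θ := by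
    refine Real.sin_pos_of_pos_of_lt_pi (by positivity) ?_
    rw [hθ, div_lt_iff₀ hh]
    nlinarith [Real.pi_pos]
  constructor
  · have := U_real_cos θ (h - 1)
    simp only [Int.cast_sub, Int.cast_natCast, Int.cast_one, sub_add_cancel, hhθ,
      Real.sin_nat_mul_pi] at this
    exact (mul_eq_zero.mp this).resolve_right hs.ne'
  · have := U_real_cos θ h
    rw [Int.cast_natCast, add_mul, hhθ, one_mul, add_comm, Real.sin_add_nat_mul_pi] at this
    exact mul_right_cancel₀ hs.ne' this

/-- The secular function at the spectral parameter `x`; the sign `δ` selects the decaying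
solution, `1` below the bulk and `-1` above it. -/
noncomputable def secularAt (s τ δ : ℝ) (h : ℕ) (x : ℝ) : ℝ :=
  secular s τ ((1 + s ^ 2 - x) / (2 * s) - δ * √(((1 + s ^ 2 - x) / (2 * s)) ^ 2 - 1))
    ((1 + s ^ 2 - x) / (2 * s) + δ * √(((1 + s ^ 2 - x) / (2 * s)) ^ 2 - 1))
    ((1 + τ ^ 2 - x) / (2 * τ)) h

lemma continuous_secularAt (s τ δ : ℝ) (h : ℕ) : Continuous (secularAt s τ δ h) := by
  have := fun m => continuous_chebU m
  unfold secularAt secular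
  refine Continuous.add (Continuous.sub ?_ ?_) ?_
  · exact Continuous.mul (by fun_prop) ((this h).comp (by fun_prop))
  · exact Continuous.mul (by fun_prop) ((this _).comp (by fun_prop))
  · exact Continuous.mul (by fun_prop) ((this _).comp (by fun_prop))

/-- Eliminating `U_{h-2}` isolates the square root: the first summand vanishes at the band edges,
the second at the zeros of `U_{h-1}`. All the sign evaluations rest on this split. -/
lemma secularAt_eq {s τ : ℝ} (hs : s ≠ 0) (δ : ℝ) (h : ℕ) (x : ℝ) :
    secularAt s τ δ h x =
      2 * (δ * s * √(((1 + s ^ 2 - x) / (2 * s)) ^ 2 - 1)) *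
        (chebU h ((1 + τ ^ 2 - x) / (2 * τ)) -
          (1 + τ ^ 2 - x) / (2 * τ) * chebU (h - 1) ((1 + τ ^ 2 - x) / (2 * τ))) +
      ((1 + s ^ 2 - x) * (1 + τ ^ 2 - x) / (2 * τ) - s ^ 2 / τ - τ) *
        chebU (h - 1) ((1 + τ ^ 2 - x) / (2 * τ)) := by
  have h1 := chebU_add_one (h - 1) ((1 + τ ^ 2 - x) / (2 * τ))
  rw [sub_add_cancel, show (h : ℤ) - 1 - 1 = h - 2 by ring] at h1
  have h2 : (1 + s ^ 2 - x) = 2 * s * ((1 + s ^ 2 - x) / (2 * s)) := by field_simp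
  rw [secularAt, secular]
  set c := (1 + τ ^ 2 - x) / (2 * τ) with hc
  have h3 : (1 + s ^ 2 - x) * (1 + τ ^ 2 - x) / (2 * τ) =
      2 * s * ((1 + s ^ 2 - x) / (2 * s)) * c := by
    rw [hc, ← h2]
    ring
  rw [h3]
  generalize (1 + s ^ 2 - x) / (2 * s) = w
  rw [show chebU (h - 2) c = 2 * c * chebU (h - 1) c - chebU h c by linarith]
  ring

lemma sqrt_discr_pos {s x : ℝ} (hs : 0 < s) (hx : x < (1 - s) ^ 2 ∨ (1 + s) ^ 2 < x) :
    0 < √(((1 + s ^ 2 - x) / (2 * s)) ^ 2 - 1) := by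
  rw [Real.sqrt_pos]
  have : ((1 + s ^ 2 - x) / (2 * s)) ^ 2 - 1 =
      ((1 - s) ^ 2 - x) * ((1 + s) ^ 2 - x) / (2 * s) ^ 2 := by
    field_simp
    ring
  rw [this]
  refine div_pos ?_ (by positivity)
  rcases hx with hx | hx
  · exact mul_pos (by linarith) (by nlinarith)
  · exact mul_pos_of_neg_of_neg (by nlinarith) (by linarith)

/-- The points `1 + τ² - 2 τ cos (j π / h)`. -/
noncomputable def node (τ : ℝ) (h j : ℕ) : ℝ := 1 + τ ^ 2 - 2 * τ * Real.cos (j * Real.pi / h)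

lemma node_lt_iff {τ : ℝ} (hτ : 0 < τ) (h j : ℕ) (x : ℝ) :
    node τ h j < x ↔ (1 + τ ^ 2 - x) / (2 * τ) < Real.cos (j * Real.pi / h) := by
  rw [div_lt_iff₀ (by positivity), node]
  constructor <;> intro <;> linarith

lemma lt_node_iff {τ : ℝ} (hτ : 0 < τ) (h j : ℕ) (x : ℝ) :
    x < node τ h j ↔ Real.cos (j * Real.pi / h) < (1 + τ ^ 2 - x) / (2 * τ) := by
  rw [lt_div_iff₀ (by positivity), node]
  constructor <;> intro <;> linarith

lemma node_strictMono {τ : ℝ} (hτ : 0 < τ) {h i j : ℕ} (hij : i < j) (hj : j ≤ h) :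
    node τ h i < node τ h j := by
  have hh : (0 : ℝ) < h := by exact_mod_cast (Nat.zero_le i).trans_lt (hij.trans_le hj)
  have hj' : (j : ℝ) ≤ h := by exact_mod_cast hj
  have hij' : (i : ℝ) < j := by exact_mod_cast hij
  have hpi := Real.pi_pos
  have : Real.cos (j * Real.pi / h) < Real.cos (i * Real.pi / h) := by
    refine Real.cos_lt_cos_of_nonneg_of_le_pi (by positivity) ?_ (by gcongr)
    rw [div_le_iff₀ hh]
    nlinarith
  unfold node
  nlinarith

lemma node_zero (τ : ℝ) (h : ℕ) : node τ h 0 = (1 - τ) ^ 2 := by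
  simp [node]
  ring

lemma node_self (τ : ℝ) {h : ℕ} (hh : 0 < h) : node τ h h = (1 + τ) ^ 2 := by
  have : (h : ℝ) ≠ 0 := by exact_mod_cast hh.ne'
  rw [node, mul_div_cancel_left₀ _ this, Real.cos_pi]
  ring

lemma secularAt_node {s τ : ℝ} (hs : s ≠ 0) (hτ : 0 < τ) (δ : ℝ) {h j : ℕ} (hj0 : 0 < j)
    (hj : j < h) : secularAt s τ δ h (node τ h j) =
      2 * (δ * s * √(((1 + s ^ 2 - node τ h j) / (2 * s)) ^ 2 - 1)) * (-1) ^ j := by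
  have hc : (1 + τ ^ 2 - node τ h j) / (2 * τ) = Real.cos (j * Real.pi / h) := by
    rw [node]
    field_simp
    ring
  obtain ⟨h1, h2⟩ := chebU_at_node hj0 hj
  rw [secularAt_eq hs, hc, h1, h2]
  ring

/-- The root vanishes at the edge, and what remains is a multiple of `U_{h-1}` by a factor
containing `τ² - s²`; its sign is where `|ρ + ε| > |ρ|` matters. -/
lemma secularAt_left_edge {s τ : ℝ} (hs : s ≠ 0) (hτ : τ ≠ 0) (δ : ℝ) (h : ℕ) :
    secularAt s τ δ h ((1 - s) ^ 2) = -((1 - s) * (τ ^ 2 - s ^ 2) / τ *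
      chebU (h - 1) ((1 + τ ^ 2 - (1 - s) ^ 2) / (2 * τ))) := by
  have h1 : (1 + s ^ 2 - (1 - s) ^ 2) / (2 * s) = 1 := by field_simp; ring
  rw [secularAt_eq hs, h1]
  simp only [one_pow, sub_self, Real.sqrt_zero, mul_zero, zero_mul, zero_add]
  field_simp
  ring

lemma secularAt_right_edge {s τ : ℝ} (hs : s ≠ 0) (hτ : τ ≠ 0) (δ : ℝ) (h : ℕ) :
    secularAt s τ δ h ((1 + s) ^ 2) = -((1 + s) * (τ ^ 2 - s ^ 2) / τ *
      chebU (h - 1) ((1 + τ ^ 2 - (1 + s) ^ 2) / (2 * τ))) := by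
  have h1 : (1 + s ^ 2 - (1 + s) ^ 2) / (2 * s) = -1 := by field_simp; ring
  rw [secularAt_eq hs, h1]
  simp only [even_two.neg_pow, one_pow, sub_self, Real.sqrt_zero, mul_zero, zero_mul, zero_add]
  field_simp
  ring

/-- The value is exactly `(1 - s²) τ⁻ʰ`. Starting the first left gap at `0` makes the zero found
there positive. -/
lemma secularAt_zero_pos {s τ : ℝ} (hs : 0 < s) (hs1 : s < 1) (hτ : 0 < τ) {h : ℕ} (hh : 1 ≤ h) :
    0 < secularAt s τ 1 h 0 := by
  obtain ⟨n, rfl⟩ : ∃ n, h = n + 1 := ⟨h - 1, by omega⟩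
  have e1 : (((n + 1 : ℕ) : ℤ)) - 1 = n := by push_cast; ring
  have hq : √(((1 + s ^ 2 - 0) / (2 * s)) ^ 2 - 1) = (1 - s ^ 2) / (2 * s) := by
    rw [Real.sqrt_eq_iff_mul_self_eq_of_pos]
    · field_simp
      ring
    · exact div_pos (by nlinarith) (by positivity)
  have hc : (1 + τ ^ 2 - 0) / (2 * τ) = (τ + τ⁻¹) / 2 := by
    field_simp
    ring
  have hrec := chebU_sub_mul hτ.ne' (n + 1)
  rw [e1] at hrec
  rw [secularAt_eq hs.ne', hq, hc, e1, show chebU ((n + 1 : ℕ) : ℤ) ((τ + τ⁻¹) / 2) =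
    τ⁻¹ ^ (n + 1) + τ * chebU n ((τ + τ⁻¹) / 2) by linarith]
  have : 0 < (1 - s ^ 2) * τ⁻¹ ^ (n + 1) := mul_pos (by nlinarith) (by positivity)
  convert this using 1
  field_simp
  ring

lemma secularAt_eventually_sign {s τ : ℝ} (hs : 0 < s) (hτ : 0 < τ) (n : ℕ) :
    ∀ᶠ x in atTop, 0 < (-1) ^ n * secularAt s τ (-1) (n + 1) x := by
  -- The first threshold puts `x` above the band; the second gives `d ≥ 1`. Together they make `(x -
  -- 1 - s²)(x - 1 - τ²)` exceed `2(s² + τ²)`.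
  filter_upwards [eventually_gt_atTop (1 + s ^ 2 + 2 * s + 2),
    eventually_gt_atTop (1 + τ ^ 2 + 2 * τ + 2 * (s ^ 2 + τ ^ 2) + 1)] with x hx1 hx2
  have e1 : (((n + 1 : ℕ) : ℤ)) - 1 = n := by push_cast; ring
  set d := (x - 1 - τ ^ 2) / (2 * τ) with hd
  have hc : (1 + τ ^ 2 - x) / (2 * τ) = -d := by
    rw [hd]
    ring
  have hd1 : 1 ≤ d := by
    rw [hd, le_div_iff₀ (by positivity)]
    nlinarith
  have hq := sqrt_discr_pos hs (x := x) (Or.inr (by nlinarith))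
  rw [secularAt_eq hs.ne', hc, e1, (chebU_neg (n + 1) d).1, (chebU_neg n d).1]
  set q := √(((1 + s ^ 2 - x) / (2 * s)) ^ 2 - 1)
  obtain ⟨hp, hle⟩ := chebU_pos hd1 n
  have hrec := chebU_add_one n d
  have hpos : 0 ≤ chebU ((n + 1 : ℕ) : ℤ) d - d * chebU n d := by
    push_cast
    rw [hrec]
    nlinarith
  have hbr : 0 < (1 + s ^ 2 - x) * (1 + τ ^ 2 - x) / (2 * τ) - s ^ 2 / τ - τ := by
    have : (1 + s ^ 2 - x) * (1 + τ ^ 2 - x) / (2 * τ) - s ^ 2 / τ - τ =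
      ((x - 1 - s ^ 2) * (x - 1 - τ ^ 2) - 2 * (s ^ 2 + τ ^ 2)) / (2 * τ) := by
      field_simp
      ring
    rw [this]
    refine div_pos ?_ (by positivity)
    nlinarith [mul_pos (show 0 < x - 1 - s ^ 2 - 1 by linarith)
      (show 0 < x - 1 - τ ^ 2 - 2 * (s ^ 2 + τ ^ 2) by linarith), sq_nonneg s, sq_nonneg τ]
  have hsq : ((-1 : ℝ) ^ n) * (-1) ^ n = 1 := by
    rw [← mul_pow]
    simp
  have key : (-1 : ℝ) ^ n * (2 * (-1 * s * q) * ((-1) ^ (n + 1) * chebU ((n + 1 : ℕ) : ℤ) d -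
      -d * ((-1) ^ n * chebU n d)) + ((1 + s ^ 2 - x) * (1 + τ ^ 2 - x) / (2 * τ) - s ^ 2 / τ - τ) *
        ((-1) ^ n * chebU n d)) = ((-1 : ℝ) ^ n * (-1) ^ n) *
      (2 * s * q * (chebU ((n + 1 : ℕ) : ℤ) d - d * chebU n d) +
      ((1 + s ^ 2 - x) * (1 + τ ^ 2 - x) / (2 * τ) - s ^ 2 / τ - τ) * chebU n d) := by
    ring
  rw [key, hsq, one_mul]
  have := mul_pos hbr hp
  have := mul_nonneg (show 0 ≤ 2 * s * q by positivity) hpos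
  linarith

lemma exists_zero_of_sign_change {F : ℝ → ℝ} (hF : Continuous F) {σ u v : ℝ} (hσ : σ ≠ 0)
    (huv : u < v) (hsign : (0 < σ * F u ∧ σ * F v < 0) ∨ (σ * F u < 0 ∧ 0 < σ * F v)) :
    ∃ x, u < x ∧ x < v ∧ F x = 0 := by
  have hc : ContinuousOn (fun x => σ * F x) (Set.Icc u v) := by fun_prop
  have : ∃ x ∈ Set.Ioo u v, σ * F x = 0 := by
    rcases hsign with hs | hs
    · exact intermediate_value_Ioo' huv.le hc ⟨hs.2, hs.1⟩
    · exact intermediate_value_Ioo huv.le hc ⟨hs.1, hs.2⟩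
  obtain ⟨x, hx, h0⟩ := this
  exact ⟨x, hx.1, hx.2, (mul_eq_zero.mp h0).resolve_left hσ⟩

lemma exists_secularAt_zero_left {s τ : ℝ} (hs : 0 < s) (hs1 : s < 1) (hτ : s < τ) {h j : ℕ}
    (hj : j < h) (hlow : j = 0 ∨ node τ h j < (1 - s) ^ 2)
    (hne : j + 1 < h → node τ h (j + 1) ≠ (1 - s) ^ 2) :
    ∃ x, 0 < x ∧ x < (1 - s) ^ 2 ∧ (0 < j → node τ h j < x) ∧ (j + 1 < h → x < node τ h (j + 1)) ∧
      secularAt s τ 1 h x = 0 := by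
  have hτ0 : 0 < τ := hs.trans hτ
  have hF := continuous_secularAt s τ 1 h
  have ha : 0 < (1 - s) ^ 2 := pow_pos (by linarith) 2
  have hsq : ∀ j : ℕ, ((-1 : ℝ) ^ j) * (-1) ^ j = 1 := fun j => by
    rw [← mul_pow]
    simp
  -- Lower end of the gap: `0` when `j = 0`, since `node τ h 0` is not a zero of `U_{h-1}`, and the
  -- node itself otherwise.
  obtain ⟨u, hu0, huj, hulow, husign⟩ : ∃ u, 0 ≤ u ∧ (0 < j → node τ h j = u) ∧
      ((j = 0 ∧ u = 0) ∨ (node τ h j = u ∧ u < (1 - s) ^ 2)) ∧ 0 < (-1) ^ j * secularAt s τ 1 h u := by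
    rcases Nat.eq_zero_or_pos j with rfl | hj0
    · exact ⟨0, le_rfl, by simp, by simp, by simpa using secularAt_zero_pos hs hs1 hτ0 hj⟩
    · have hlow' := hlow.resolve_left hj0.ne'
      refine ⟨node τ h j, ?_, fun _ => rfl, Or.inr ⟨rfl, hlow'⟩, ?_⟩
      · have := node_strictMono hτ0 hj0 hj.le
        rw [node_zero] at this
        exact (sq_nonneg _).trans this.le
      · rw [secularAt_node hs.ne' hτ0 1 hj0 hj, mul_comm, mul_assoc, hsq]
        have := sqrt_discr_pos hs (Or.inl hlow')
        positivity
  have hua : u < (1 - s) ^ 2 := by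
    rcases hulow with h1 | h1
    · rw [h1.2]
      exact ha
    · exact h1.2
  -- Upper end: the next node if it lies below the band, otherwise the band edge. Excluding a node
  -- at the edge keeps `U_{h-1}` nonzero there.
  obtain ⟨v, huv, hva, hvj, hvsign⟩ : ∃ v, u < v ∧ v ≤ (1 - s) ^ 2 ∧
      (j + 1 < h → v ≤ node τ h (j + 1)) ∧ (-1) ^ j * secularAt s τ 1 h v < 0 := by
    by_cases hv : j + 1 < h ∧ node τ h (j + 1) < (1 - s) ^ 2
    · refine ⟨node τ h (j + 1), ?_, hv.2.le, fun _ => le_rfl, ?_⟩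
      · rcases Nat.eq_zero_or_pos j with rfl | hj0
        · have hu : u = 0 ∨ node τ h 0 = u := hulow.imp (·.2) (·.1)
          have := node_strictMono hτ0 (Nat.lt_succ_self 0) hv.1.le
          rcases hu with rfl | rfl
          · rw [node_zero] at this
            exact (sq_nonneg _).trans_lt this
          · exact this
        · rw [← huj hj0]
          exact node_strictMono hτ0 (Nat.lt_succ_self j) hv.1.le
      · rw [secularAt_node hs.ne' hτ0 1 (show 0 < j + 1 by omega) hv.1, pow_succ (-1 : ℝ) j]
        have h1 := sqrt_discr_pos hs (Or.inl hv.2)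
        have h2 := hsq j
        set q := √(((1 + s ^ 2 - node τ h (j + 1)) / (2 * s)) ^ 2 - 1)
        have : (-1 : ℝ) ^ j * (2 * (1 * s * q) * ((-1) ^ j * -1)) =
          -(((-1 : ℝ) ^ j * (-1) ^ j) * (2 * s * q)) := by ring
        rw [this, h2]
        have : 0 < 2 * s * q := by positivity
        linarith
    · refine ⟨(1 - s) ^ 2, hua, le_rfl, fun h1 => ?_, ?_⟩
      · exact not_lt.mp fun h2 => hv ⟨h1, h2⟩
      · have hup : (1 - s) ^ 2 < node τ h (j + 1) := by
          rcases Nat.lt_or_ge (j + 1) h with h1 | h1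
          · exact lt_of_le_of_ne (not_lt.mp fun h2 => hv ⟨h1, h2⟩) (hne h1).symm
          · rw [show j + 1 = h by omega, node_self τ (by omega)]
            nlinarith
        have hsgn := chebU_sign hj ((lt_node_iff hτ0 h (j + 1) _).mp hup)
          (hlow.imp_right (node_lt_iff hτ0 h j _).mp)
        rw [secularAt_left_edge hs.ne' hτ0.ne']
        have : 0 < (1 - s) * (τ ^ 2 - s ^ 2) / τ :=
          div_pos (mul_pos (by linarith) (by nlinarith)) hτ0
        nlinarith [mul_pos this hsgn]
  obtain ⟨x, h1, h2, h3⟩ := exists_zero_of_sign_change hF (pow_ne_zero j (by norm_num)) huv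
    (Or.inl ⟨husign, hvsign⟩)
  exact ⟨x, hu0.trans_lt h1, h2.trans_le hva, fun h0 => (huj h0).trans_lt h1,
    fun h0 => h2.trans_le (hvj h0), h3⟩

/-- Mirror image of the left case, with signs reversed. The last gap is unbounded, and its upper end
is supplied by the sign near `+∞`. -/
lemma exists_secularAt_zero_right {s τ : ℝ} (hs : 0 < s) (hτ : s < τ) {h j : ℕ}
    (hj : j < h) (hup : j + 1 = h ∨ (1 + s) ^ 2 < node τ h (j + 1))
    (hne : 0 < j → node τ h j ≠ (1 + s) ^ 2) :
    ∃ x, (1 + s) ^ 2 < x ∧ (0 < j → node τ h j < x) ∧ (j + 1 < h → x < node τ h (j + 1)) ∧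
      secularAt s τ (-1) h x = 0 := by
  have hτ0 : 0 < τ := hs.trans hτ
  have hF := continuous_secularAt s τ (-1) h
  have hsq : ∀ j : ℕ, ((-1 : ℝ) ^ j) * (-1) ^ j = 1 := fun j => by
    rw [← mul_pow]
    simp
  have hupn : (1 + s) ^ 2 < node τ h (j + 1) := by
    rcases hup with h1 | h1
    · rw [h1, node_self τ (by omega)]
      nlinarith
    · exact h1
  obtain ⟨u, hub, huj, hun, husign⟩ : ∃ u, (1 + s) ^ 2 ≤ u ∧ (0 < j → node τ h j ≤ u) ∧
      u < node τ h (j + 1) ∧ (-1) ^ j * secularAt s τ (-1) h u < 0 := by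
    by_cases hu : 0 < j ∧ (1 + s) ^ 2 < node τ h j
    · refine ⟨node τ h j, hu.2.le, fun _ => le_rfl, node_strictMono hτ0 (Nat.lt_succ_self j) hj, ?_⟩
      rw [secularAt_node hs.ne' hτ0 (-1) hu.1 hj, mul_comm, mul_assoc, hsq]
      have h1 := sqrt_discr_pos hs (Or.inr hu.2)
      have := mul_pos hs h1
      linarith
    · refine ⟨(1 + s) ^ 2, le_rfl, fun h0 => not_lt.mp fun h1 => hu ⟨h0, h1⟩, hupn, ?_⟩
      have hsgn := chebU_sign hj ((lt_node_iff hτ0 h (j + 1) _).mp hupn) (by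
        rcases Nat.eq_zero_or_pos j with h0 | h0
        · exact Or.inl h0
        · exact Or.inr ((node_lt_iff hτ0 h j _).mp
            (lt_of_le_of_ne (not_lt.mp fun h1 => hu ⟨h0, h1⟩) (hne h0))))
      rw [secularAt_right_edge hs.ne' hτ0.ne']
      have : 0 < (1 + s) * (τ ^ 2 - s ^ 2) / τ :=
        div_pos (mul_pos (by linarith) (by nlinarith)) hτ0
      nlinarith [mul_pos this hsgn]
  obtain ⟨v, huv, hvj, hvsign⟩ : ∃ v, u < v ∧ (j + 1 < h → v ≤ node τ h (j + 1)) ∧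
      0 < (-1) ^ j * secularAt s τ (-1) h v := by
    rcases Nat.lt_or_ge (j + 1) h with h1 | h1
    · refine ⟨node τ h (j + 1), hun, fun _ => le_rfl, ?_⟩
      rw [secularAt_node hs.ne' hτ0 (-1) (show 0 < j + 1 by omega) h1, pow_succ (-1 : ℝ) j]
      have h3 := sqrt_discr_pos hs (Or.inr hupn)
      have h2 := hsq j
      set q := √(((1 + s ^ 2 - node τ h (j + 1)) / (2 * s)) ^ 2 - 1)
      have : (-1 : ℝ) ^ j * (2 * (-1 * s * q) * ((-1) ^ j * -1)) =
        ((-1 : ℝ) ^ j * (-1) ^ j) * (2 * s * q) := by ring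
      rw [this, h2]
      positivity
    · obtain rfl : h = j + 1 := by omega
      obtain ⟨v, hv1, hv2⟩ :=
        ((secularAt_eventually_sign hs hτ0 j).and (eventually_gt_atTop u)).exists
      exact ⟨v, hv2, fun h0 => absurd h0 (lt_irrefl _), hv1⟩
  obtain ⟨x, h1, h2, h3⟩ := exists_zero_of_sign_change hF (pow_ne_zero j (by norm_num)) huv
    (Or.inr ⟨husign, hvsign⟩)
  exact ⟨x, hub.trans_lt h1, fun h0 => (huj h0).trans_lt h1,
    fun h0 => h2.trans_le (hvj h0), h3⟩

end SCM

/-! ### From secular zeros to outliers, for arbitrary signs. -/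

namespace SCM

lemma exists_sign_mul_abs (ρ : ℝ) : ∃ η : ℝ, (η = 1 ∨ η = -1) ∧ ρ = η * |ρ| := by
  rcases le_total 0 ρ with h | h
  · exact ⟨1, Or.inl rfl, by simp [abs_of_nonneg h]⟩
  · exact ⟨-1, Or.inr rfl, by simp [abs_of_nonpos h]⟩

lemma secular_neg {s τ R R' c : ℝ} (n : ℕ) :
    secular s (-τ) R R' (-c) (n + 1) = (-1) ^ (n + 1) * secular s τ R R' c (n + 1) := by
  have e1 : (((n + 1 : ℕ) : ℤ)) - 1 = n := by push_cast; ring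
  have e2 : (((n + 1 : ℕ) : ℤ)) - 2 = n - 1 := by push_cast; ring
  rw [secular, secular, e1, e2, (chebU_neg (n + 1) c).1, (chebU_neg n c).1, (chebU_neg n c).2,
    div_neg]
  ring

lemma exists_boundState_of_secularAt {ρ σ δ x : ℝ} {h : ℕ} (hh : 1 ≤ h) (hρ : ρ ≠ 0) (hσ : σ ≠ 0)
    (hside : (δ = 1 ∧ x < (1 - |ρ|) ^ 2) ∨ (δ = -1 ∧ (1 + |ρ|) ^ 2 < x))
    (h0 : secularAt |ρ| |σ| δ h x = 0) :
    ∃ u : ℤ → ℝ, u 0 = 1 ∧ Tendsto u atTop (𝓝 0) ∧ Tendsto u atBot (𝓝 0) ∧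
      ∀ m, (1 + coupling ρ σ h m ^ 2) * u m - coupling ρ σ h m * u (m + 1) -
        coupling ρ σ h (m - 1) * u (m - 1) = x * u m := by
  obtain ⟨η, hη, hρη⟩ := exists_sign_mul_abs ρ
  obtain ⟨ζ, hζ, hσζ⟩ := exists_sign_mul_abs σ
  have hη2 : η * η = 1 := by rcases hη with rfl | rfl <;> norm_num
  have hζ2 : ζ * ζ = 1 := by rcases hζ with rfl | rfl <;> norm_num
  have hs : 0 < |ρ| := abs_pos.mpr hρ
  have hτ : 0 < |σ| := abs_pos.mpr hσ
  have hq := sqrt_discr_pos hs (hside.imp And.right And.right)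
  rw [secularAt] at h0
  set s := |ρ| with hs_def
  set τ := |σ| with hτ_def
  set w := (1 + s ^ 2 - x) / (2 * s) with hw
  set c := (1 + τ ^ 2 - x) / (2 * τ) with hc
  set q := √(w ^ 2 - 1) with hq_def
  have hqq : q * q = w ^ 2 - 1 := Real.mul_self_sqrt (Real.sqrt_pos.mp hq).le
  have hws : 2 * s * w = 1 + s ^ 2 - x := by rw [hw]; field_simp
  have hcτ : 2 * τ * c = 1 + τ ^ 2 - x := by rw [hc]; field_simp
  have hδ2 : δ * δ = 1 := by rcases hside with ⟨rfl, -⟩ | ⟨rfl, -⟩ <;> norm_num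
  have hprod : (w - δ * q) * (w + δ * q) = 1 := by
    have : (w - δ * q) * (w + δ * q) = w ^ 2 - (δ * δ) * (q * q) := by ring
    rw [this, hδ2, hqq]
    ring
  have hlt : |w - δ * q| < 1 := by
    rw [abs_lt]
    rcases hside with ⟨rfl, hx⟩ | ⟨rfl, hx⟩
    · have : 1 < w := by
        rw [hw, lt_div_iff₀ (by positivity)]
        linarith
      constructor <;> nlinarith
    · have : w < -1 := by
        rw [hw, div_lt_iff₀ (by positivity)]
        linarith
      constructor <;> nlinarith
  -- The signs `η` of `ρ` and `ζ` of `σ` are absorbed into the multiplier `R` and the argument `c`.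
  refine exists_boundState (R := η * (w - δ * q)) (R' := η * (w + δ * q)) (c := ζ * c) hh hσ
    ?_ ?_ ?_ ?_ ?_
  · linear_combination (w - δ * q) * (w + δ * q) * hη2 + hprod
  · rw [abs_mul]
    rcases hη with rfl | rfl <;> simpa using hlt
  · rw [hρη]
    linear_combination (2 * s * w - s ^ 2) * hη2 + hws
  · rw [hσζ]
    linear_combination (2 * τ * c - τ ^ 2) * hζ2 + hcτ
  · have h1 : secular ρ σ (η * (w - δ * q)) (η * (w + δ * q)) (ζ * c) h =
        secular s σ (w - δ * q) (w + δ * q) (ζ * c) h := by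
      have e1 : ρ * (η * (w + δ * q)) = s * (w + δ * q) := by
        conv_lhs => rw [hρη]
        linear_combination s * (w + δ * q) * hη2
      have e2 : ρ * (η * (w - δ * q)) = s * (w - δ * q) := by
        conv_lhs => rw [hρη]
        linear_combination s * (w - δ * q) * hη2
      have e3 : ρ ^ 2 = s ^ 2 := (sq_abs ρ).symm
      rw [secular, secular, e1, e2, e3]
    rw [h1, hσζ]
    rcases hζ with rfl | rfl
    · rw [one_mul, one_mul]
      exact h0
    · obtain ⟨n, rfl⟩ : ∃ n, h = n + 1 := ⟨h - 1, by omega⟩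
      rw [neg_one_mul, neg_one_mul, secular_neg, h0, mul_zero]

lemma arCoeff_eq_coupling (ρ ε : ℝ) (k : ℕ) {h : ℕ} (hh : 1 ≤ h) (t : ℕ) :
    arCoeff ρ ε k h t = coupling ρ (ρ + ε) h ((t : ℤ) - k) := by
  rw [arCoeff, coupling, Set.indicator_apply]
  have : t ∈ Set.Icc k (k + h - 1) ↔ 0 ≤ (t : ℤ) - k ∧ (t : ℤ) - k < h := by
    rw [Set.mem_Icc]
    omega
  simp only [this]
  split_ifs <;> simp

section Outliers
variable {Ω : Type*} [MeasurableSpace Ω] {P : Measure Ω} [IsProbabilityMeasure P]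
  {z : ℕ → Ω → ℝ} {ρ ε : ℝ} {h : ℕ} {k : ℕ → ℕ}

lemma scmPrecision_eq (hz : IsWhiteNoise P z) :
    scmPrecision P z ρ ε k h = fun n => jacobiMatrix (arCoeff ρ ε (k n) h) n :=
  funext fun n => precisionMatrix_arProcess hz _ n

lemma abs_coupling_le (ρ σ : ℝ) (h : ℕ) (m : ℤ) : |coupling ρ σ h m| ≤ max |ρ| |σ| := by
  unfold coupling
  split_ifs <;> simp

lemma isASD_scmPrecision (hz : IsWhiteNoise P z) (hh : 1 ≤ h) :
    IsASD (scmPrecision P z ρ ε k h) (symbolLaw ρ) := by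
  rw [scmPrecision_eq hz]
  refine isASD_jacobiMatrix (k := k) (h := h) (κ := max |ρ| |ρ + ε|) (fun n t => ?_)
    (fun n t ht => ?_) (le_max_left _ _)
  · rw [arCoeff_eq_coupling ρ ε _ hh]
    exact abs_coupling_le _ _ _ _
  · rw [arCoeff_eq_coupling ρ ε _ hh]
    exact if_neg (by omega)

lemma closure_support_symbolLaw (ρ : ℝ) :
    closure (symbolLaw ρ).support = Set.Icc (aBound ρ) (bBound ρ) := by
  rw [support_symbolLaw, isClosed_Icc.closure_eq]

lemma aBound_le_bBound (ρ : ℝ) : aBound ρ ≤ bBound ρ :=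
  (symbol_mem_Icc ρ 0).1.trans (symbol_mem_Icc ρ 0).2

lemma mem_out_of_secularAt (hz : IsWhiteNoise P z) (hh : 1 ≤ h) (hk : Tendsto k atTop atTop)
    (hnk : Tendsto (fun n => n - k n) atTop atTop) (hρ : ρ ≠ 0) (hσ : ρ + ε ≠ 0) {δ x : ℝ}
    (hside : (δ = 1 ∧ x < aBound ρ) ∨ (δ = -1 ∧ bBound ρ < x))
    (h0 : secularAt |ρ| |ρ + ε| δ h x = 0) : x ∈ out (scmPrecision P z ρ ε k h) := by
  obtain ⟨u, hu0, htop, hbot, heq⟩ := exists_boundState_of_secularAt hh hρ hσ hside h0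
  refine ⟨symbolLaw ρ, isASD_scmPrecision hz hh, ?_, ?_⟩
  · rw [scmPrecision_eq hz]
    exact tendsto_infDist_spectrum_jacobiMatrix (abs_coupling_le _ _ _) hu0 htop hbot heq hk hnk
      fun n t => arCoeff_eq_coupling ρ ε (k n) hh t
  · rw [closure_support_symbolLaw]
    rintro ⟨h1, h2⟩
    rcases hside with h3 | h3 <;> linarith [h3.2]

lemma exists_mem_outL (hz : IsWhiteNoise P z) (hk : Tendsto k atTop atTop)
    (hnk : Tendsto (fun n => n - k n) atTop atTop) (hρ : ρ ≠ 0) (hρ1 : |ρ| < 1)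
    (hmag : |ρ| < |ρ + ε|) {j : ℕ} (hj : j < h) (hlow : j = 0 ∨ node |ρ + ε| h j < aBound ρ)
    (hne : j + 1 < h → node |ρ + ε| h (j + 1) ≠ aBound ρ) :
    ∃ x ∈ outL (scmPrecision P z ρ ε k h), 0 < x ∧ x < aBound ρ ∧
      (0 < j → node |ρ + ε| h j < x) ∧ (j + 1 < h → x < node |ρ + ε| h (j + 1)) := by
  obtain ⟨x, h1, h2, h3, h4, h5⟩ :=
    exists_secularAt_zero_left (abs_pos.mpr hρ) hρ1 hmag hj hlow hne
  have hh : 1 ≤ h := by omega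
  have hσ : ρ + ε ≠ 0 := abs_pos.mp ((abs_nonneg ρ).trans_lt hmag)
  exact ⟨x, ⟨mem_out_of_secularAt hz hh hk hnk hρ hσ (Or.inl ⟨rfl, h2⟩) h5, symbolLaw ρ, aBound ρ,
    bBound ρ, isASD_scmPrecision hz hh, aBound_le_bBound ρ, closure_support_symbolLaw ρ, h2⟩,
    h1, h2, h3, h4⟩

lemma exists_mem_outR (hz : IsWhiteNoise P z) (hk : Tendsto k atTop atTop)
    (hnk : Tendsto (fun n => n - k n) atTop atTop) (hρ : ρ ≠ 0)
    (hmag : |ρ| < |ρ + ε|) {j : ℕ} (hj : j < h)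
    (hup : j + 1 = h ∨ bBound ρ < node |ρ + ε| h (j + 1))
    (hne : 0 < j → node |ρ + ε| h j ≠ bBound ρ) :
    ∃ x ∈ outR (scmPrecision P z ρ ε k h), bBound ρ < x ∧
      (0 < j → node |ρ + ε| h j < x) ∧ (j + 1 < h → x < node |ρ + ε| h (j + 1)) := by
  obtain ⟨x, h2, h3, h4, h5⟩ := exists_secularAt_zero_right (abs_pos.mpr hρ) hmag hj hup hne
  have hh : 1 ≤ h := by omega
  have hσ : ρ + ε ≠ 0 := abs_pos.mp ((abs_nonneg ρ).trans_lt hmag)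
  exact ⟨x, ⟨mem_out_of_secularAt hz hh hk hnk hρ hσ (Or.inr ⟨rfl, h2⟩) h5, symbolLaw ρ, aBound ρ,
    bBound ρ, isASD_scmPrecision hz hh, aBound_le_bBound ρ, closure_support_symbolLaw ρ, h2⟩,
    h2, h3, h4⟩

end Outliers

/-! ### Matching the points `x_j` with ordered nodes, and counting. -/

lemma xReal_eq_node_of_pos {ρ ε : ℝ} (hσ : 0 < ρ + ε) (h j : ℕ) :
    xReal ρ ε h j = node |ρ + ε| h j := by
  rw [xReal, node, abs_of_pos hσ, add_comm ε ρ]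

lemma xReal_eq_node_of_neg {ρ ε : ℝ} (hσ : ρ + ε < 0) {h j : ℕ} (hh : 1 ≤ h) (hj : j ≤ h) :
    xReal ρ ε h j = node |ρ + ε| h (h - j) := by
  have h0 : (h : ℝ) ≠ 0 := by positivity
  have : ((h - j : ℕ) : ℝ) * Real.pi / h = Real.pi - j * Real.pi / h := by
    rw [Nat.cast_sub hj]
    field_simp
  rw [xReal, node, this, Real.cos_pi_sub, abs_of_neg hσ, add_comm ε ρ]
  ring

lemma node_ne_of_xReal {ρ ε v : ℝ} (hσ : ρ + ε ≠ 0) {h : ℕ}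
    (hx : ∀ j : ℕ, 1 ≤ j → j < h → xReal ρ ε h j ≠ v) {j : ℕ} (hj0 : 0 < j) (hj : j < h) :
    node |ρ + ε| h j ≠ v := by
  rcases hσ.lt_or_gt with h1 | h1
  · have := hx (h - j) (by omega) (by omega)
    rwa [xReal_eq_node_of_neg h1 (by omega) (by omega), Nat.sub_sub_self hj.le] at this
  · have := hx j hj0 hj
    rwa [xReal_eq_node_of_pos h1] at this

/-- At most one of the two infinite points satisfies a one-sided condition. -/
lemma ncard_xPt_le {ρ ε : ℝ} (hσ : ρ + ε ≠ 0) {h : ℕ} (Q : EReal → Prop) [DecidablePred Q]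
    (hQ : ¬ Q ⊤ ∨ ¬ Q ⊥) :
    {j : ℕ | j ≤ h ∧ Q (xPt ρ ε h j)}.ncard ≤
      ((Finset.Ico 1 h).filter fun i => Q (node |ρ + ε| h i : ℝ)).card + 1 := by
  set T := (Finset.Ico 1 h).filter fun i => Q (node |ρ + ε| h i : ℝ) with hT
  -- `e` is the only endpoint index that can be counted; it accounts for the `+ 1`.
  obtain ⟨e, he⟩ : ∃ e, ∀ j ≤ h, Q (xPt ρ ε h j) → j = e ∨ (1 ≤ j ∧ j < h) := by
    have h0 : xPt ρ ε h 0 = if 0 < ρ then ⊥ else ⊤ := if_pos rfl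
    have h1 : h ≠ 0 → xPt ρ ε h h = if 0 < ρ then ⊤ else ⊥ := fun hh => by
      rw [xPt, if_neg hh, if_pos rfl]
    by_cases hex : Q (xPt ρ ε h 0)
    · refine ⟨0, fun j hj hQj => ?_⟩
      by_contra hcon
      obtain rfl : j = h := by omega
      rw [h1 (by omega)] at hQj
      rw [h0] at hex
      split_ifs at hex hQj <;> tauto
    · refine ⟨h, fun j hj hQj => ?_⟩
      by_contra hcon
      obtain rfl : j = 0 := by omega
      exact hex hQj
  -- `φ` is the identity or the reflection `j ↦ h - j`, according to the sign of `ρ + ε`. As an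
  -- involution it preserves the count.
  obtain ⟨φ, hφ1, hφ2⟩ : ∃ φ : ℕ → ℕ, (∀ j, 1 ≤ j → j < h → 1 ≤ φ j ∧ φ j < h ∧ φ (φ j) = j) ∧
      ∀ j, 1 ≤ j → j < h → xReal ρ ε h j = node |ρ + ε| h (φ j) := by
    rcases hσ.lt_or_gt with h1 | h1
    · exact ⟨fun j => h - j, fun j _ _ => ⟨by grind, by grind, by grind⟩,
        fun j _ _ => xReal_eq_node_of_neg h1 (by omega) (by omega)⟩
    · exact ⟨id, fun j h2 h3 => ⟨h2, h3, rfl⟩, fun j _ _ => xReal_eq_node_of_pos h1 h j⟩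
  have hsub : {j : ℕ | j ≤ h ∧ Q (xPt ρ ε h j)} ⊆ (insert e (T.image φ) : Finset ℕ) := by
    rintro j ⟨hj, hQj⟩
    rw [Finset.mem_coe, Finset.mem_insert, Finset.mem_image]
    refine (he j hj hQj).imp_right fun hj' => ⟨φ j, ?_, (hφ1 j hj'.1 hj'.2).2.2⟩
    rw [xPt, if_neg (by omega), if_neg (by omega), hφ2 j hj'.1 hj'.2] at hQj
    simp only [hT, Finset.mem_filter, Finset.mem_Ico]
    exact ⟨⟨(hφ1 j hj'.1 hj'.2).1, (hφ1 j hj'.1 hj'.2).2.1⟩, hQj⟩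
  calc _ ≤ ((insert e (T.image φ) : Finset ℕ) : Set ℕ).ncard :=
        Set.ncard_le_ncard hsub (Finset.finite_toSet _)
    _ ≤ _ := by
        rw [Set.ncard_coe_finset]
        exact (Finset.card_insert_le _ _).trans (Nat.add_le_add_right Finset.card_image_le 1)

/-- Nodes increase, so those below the band form an initial segment. If node `j ≥ 1` were not among
them, at most `j - 1` interior nodes and one infinite point would be counted. -/
lemma index_of_lt_numL {ρ ε : ℝ} (hσ : ρ + ε ≠ 0) {h j : ℕ} (hh : 1 ≤ h) (hj : j < numL ρ ε h) :
    j < h ∧ (j = 0 ∨ node |ρ + ε| h j < aBound ρ) := by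
  classical
  have hle := ncard_xPt_le (ρ := ρ) hσ (h := h) (fun y => y < (aBound ρ : EReal)) (Or.inl (by simp))
  change numL ρ ε h ≤ _ at hle
  simp only [EReal.coe_lt_coe_iff] at hle
  have hjh : j < h := by
    have := Finset.card_filter_le (Finset.Ico 1 h) fun i => node |ρ + ε| h i < aBound ρ
    rw [Nat.card_Ico] at this
    omega
  refine ⟨hjh, ?_⟩
  by_contra! hcon
  have hsub : ((Finset.Ico 1 h).filter fun i => node |ρ + ε| h i < aBound ρ) ⊆ Finset.Ico 1 j := by
    intro i hi
    simp only [Finset.mem_filter, Finset.mem_Ico] at hi ⊢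
    refine ⟨hi.1.1, ?_⟩
    by_contra! hji
    rcases hji.eq_or_lt with rfl | hji
    · linarith
    · linarith [node_strictMono (abs_pos.mpr hσ) hji hi.1.2.le]
  have := Finset.card_le_card hsub
  rw [Nat.card_Ico] at this
  omega

lemma index_of_le_numR {ρ ε : ℝ} (hσ : ρ + ε ≠ 0) {h l : ℕ} (hh : 1 ≤ h) (hl0 : 1 ≤ l)
    (hl : l ≤ numR ρ ε h) :
    l ≤ h ∧ (l = 1 ∨ bBound ρ < node |ρ + ε| h (h - l + 1)) := by
  classical
  have hle := ncard_xPt_le (ρ := ρ) hσ (h := h) (fun y => (bBound ρ : EReal) < y) (Or.inr (by simp))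
  change numR ρ ε h ≤ _ at hle
  simp only [EReal.coe_lt_coe_iff] at hle
  have hlh : l ≤ h := by
    have := Finset.card_filter_le (Finset.Ico 1 h) fun i => bBound ρ < node |ρ + ε| h i
    rw [Nat.card_Ico] at this
    omega
  refine ⟨hlh, ?_⟩
  by_contra! hcon
  have hsub : ((Finset.Ico 1 h).filter fun i => bBound ρ < node |ρ + ε| h i) ⊆
      Finset.Ico (h - l + 2) h := by
    intro i hi
    simp only [Finset.mem_filter, Finset.mem_Ico] at hi ⊢
    refine ⟨?_, hi.1.2⟩
    by_contra! hji
    rcases (show i ≤ h - l + 1 by omega).eq_or_lt with rfl | hji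
    · linarith
    · linarith [node_strictMono (abs_pos.mpr hσ) hji (show h - l + 1 ≤ h by omega)]
  have := Finset.card_le_card hsub
  rw [Nat.card_Ico] at this
  omega

/-- The chosen points lie in pairwise disjoint gaps, hence are distinct. -/
lemma card_le_encard_of_separated {S : Set ℝ} {J : Finset ℕ} {y : ℕ → ℝ} {h : ℕ}
    (hy : ∀ i j, i < j → j ≤ h → y i < y j) (hJ : ∀ j ∈ J, j < h ∧ ∃ x ∈ S,
      (0 < j → y j < x) ∧ (j + 1 < h → x < y (j + 1))) : (J.card : ℕ∞) ≤ S.encard := by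
  choose! hJh X hXS hXl hXu using hJ
  have hlt : ∀ i ∈ J, ∀ j ∈ J, i < j → X i < X j := by
    intro i hi j hj hij
    have h1 := hXu i hi (by have := hJh j hj; omega)
    have h2 := hXl j hj (by omega)
    rcases (show i + 1 ≤ j from hij).eq_or_lt with h3 | h3
    · rw [h3] at h1
      exact h1.trans h2
    · exact h1.trans ((hy _ _ h3 (hJh j hj).le).trans h2)
  have hinj : Set.InjOn X J := by
    intro i hi j hj hij
    rcases lt_trichotomy i j with h1 | h1 | h1
    · exact absurd hij (hlt i hi j hj h1).ne
    · exact h1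
    · exact absurd hij (hlt j hj i hi h1).ne'
  rw [← Set.encard_coe_eq_coe_finsetCard, ← hinj.encard_image]
  exact Set.encard_le_encard (Set.image_subset_iff.mpr fun j hj => hXS j hj)

/-- The points `x_j` in increasing order, when `ρ` and `ρ + ε` have the same sign. -/
lemma xPt_of_same_sign {ρ ε : ℝ} (hsign : 0 < ρ * (ρ + ε)) {h j : ℕ} (hh : 1 ≤ h) (hj : j ≤ h) :
    xPt ρ ε h (if 0 < ρ then j else h - j) =
      if j = 0 then ⊥ else if j = h then ⊤ else ((node |ρ + ε| h j : ℝ) : EReal) := by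
  rcases pos_and_pos_or_neg_and_neg_of_mul_pos hsign with ⟨h1, h2⟩ | ⟨h1, h2⟩
  · rw [if_pos h1, xPt, if_pos h1, if_pos h1, xReal_eq_node_of_pos h2]
  · rw [if_neg h1.not_gt, xPt, if_neg h1.not_gt, if_neg h1.not_gt,
      xReal_eq_node_of_neg h2 hh (by omega), Nat.sub_sub_self hj]
    split_ifs <;> first | rfl | omega

lemma xPt_lt_of_node_lt {ρ ε x : ℝ} (hsign : 0 < ρ * (ρ + ε)) {h j : ℕ} (hj : j < h)
    (hx : 0 < j → node |ρ + ε| h j < x) : xPt ρ ε h (if 0 < ρ then j else h - j) < x := by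
  rw [xPt_of_same_sign hsign (by omega) hj.le]
  split_ifs with h1 h2
  · exact EReal.bot_lt_coe x
  · omega
  · exact EReal.coe_lt_coe_iff.mpr (hx (by omega))

lemma lt_xPt_of_lt_node {ρ ε x : ℝ} (hsign : 0 < ρ * (ρ + ε)) {h j : ℕ} (hj : j < h)
    (hx : j + 1 < h → x < node |ρ + ε| h (j + 1)) :
    x < xPt ρ ε h (if 0 < ρ then j + 1 else h - (j + 1)) := by
  rw [xPt_of_same_sign hsign (by omega) hj, if_neg (Nat.succ_ne_zero j)]
  split_ifs with h1
  · exact EReal.coe_lt_top x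
  · exact EReal.coe_lt_coe_iff.mpr (hx (by omega))

end SCM

/-! ### Assembly. -/

theorem theorem3p5 {Ω : Type*} [MeasurableSpace Ω] (P : Measure Ω) [IsProbabilityMeasure P]
    (z : ℕ → Ω → ℝ) (hz : SCM.IsWhiteNoise P z)
    (ρ ε : ℝ) (hρ0 : ρ ≠ 0) (hρ1 : |ρ| < 1) (hmag : |ρ| < |ρ + ε|)
    (h : ℕ) (hh : 1 ≤ h)
    (k : ℕ → ℕ) (hk : Tendsto k atTop atTop) (hnk : Tendsto (fun n => n - k n) atTop atTop)
    (hx : ∀ j : ℕ, 1 ≤ j → j < h →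
      (SCM.xReal ρ ε h j - SCM.aBound ρ) * (SCM.xReal ρ ε h j - SCM.bBound ρ) ≠ 0) :
    (SCM.numL ρ ε h : ℕ∞) ≤ (SCM.outL (SCM.scmPrecision P z ρ ε k h)).encard ∧
    (SCM.numR ρ ε h : ℕ∞) ≤ (SCM.outR (SCM.scmPrecision P z ρ ε k h)).encard ∧
    (0 < ρ * (ρ + ε) →
      (∀ j : ℕ, 1 ≤ j → j ≤ SCM.numL ρ ε h →
        (SCM.intervalL ρ ε h j ∩ SCM.outL (SCM.scmPrecision P z ρ ε k h)).Nonempty) ∧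
      (∀ l : ℕ, 1 ≤ l → l ≤ SCM.numR ρ ε h →
        (SCM.intervalR ρ ε h l ∩ SCM.outR (SCM.scmPrecision P z ρ ε k h)).Nonempty)) := by
  have hσ : ρ + ε ≠ 0 := abs_pos.mp ((abs_nonneg ρ).trans_lt hmag)
  have hmono : ∀ i j, i < j → j ≤ h → SCM.node |ρ + ε| h i < SCM.node |ρ + ε| h j :=
    fun i j => SCM.node_strictMono (abs_pos.mpr hσ)
  have hL : ∀ j < SCM.numL ρ ε h, j < h ∧ ∃ x ∈ SCM.outL (SCM.scmPrecision P z ρ ε k h),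
      0 < x ∧ x < SCM.aBound ρ ∧ (0 < j → SCM.node |ρ + ε| h j < x) ∧
        (j + 1 < h → x < SCM.node |ρ + ε| h (j + 1)) := fun j hj => by
    obtain ⟨hjh, hlow⟩ := SCM.index_of_lt_numL hσ hh hj
    exact ⟨hjh, SCM.exists_mem_outL hz hk hnk hρ0 hρ1 hmag hjh hlow fun h1 =>
      SCM.node_ne_of_xReal hσ (fun i h2 h3 => sub_ne_zero.mp (left_ne_zero_of_mul (hx i h2 h3)))
        (Nat.succ_pos j) h1⟩
  have hR : ∀ l, 1 ≤ l → l ≤ SCM.numR ρ ε h → l ≤ h ∧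
      ∃ x ∈ SCM.outR (SCM.scmPrecision P z ρ ε k h), SCM.bBound ρ < x ∧
        (0 < h - l → SCM.node |ρ + ε| h (h - l) < x) ∧
        (h - l + 1 < h → x < SCM.node |ρ + ε| h (h - l + 1)) := fun l hl0 hl => by
    obtain ⟨hlh, hup⟩ := SCM.index_of_le_numR hσ hh hl0 hl
    exact ⟨hlh, SCM.exists_mem_outR hz hk hnk hρ0 hmag (by omega)
      (hup.imp_left fun h1 => by omega) fun h1 =>
      SCM.node_ne_of_xReal hσ (fun i h2 h3 => sub_ne_zero.mp (right_ne_zero_of_mul (hx i h2 h3)))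
        h1 (by omega)⟩
  refine ⟨?_, ?_, fun hsign => ⟨fun j hj0 hj => ?_, fun l hl0 hl => ?_⟩⟩
  · rw [← Finset.card_range (SCM.numL ρ ε h)]
    refine SCM.card_le_encard_of_separated hmono fun j hj => ?_
    obtain ⟨h1, x, h2, -, -, h3⟩ := hL j (Finset.mem_range.mp hj)
    exact ⟨h1, x, h2, h3⟩
  · rcases Nat.eq_zero_or_pos (SCM.numR ρ ε h) with h0 | h0
    · simp [h0]
    have hle := (hR _ h0 le_rfl).1
    -- Right gaps are numbered from the top: the outlier with label `l` lies in gap `h - l`.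
    have hcard : (Finset.Ico (h - SCM.numR ρ ε h) h).card = SCM.numR ρ ε h := by
      rw [Nat.card_Ico]
      omega
    rw [← hcard]
    refine SCM.card_le_encard_of_separated hmono fun j hj => ?_
    rw [Finset.mem_Ico] at hj
    obtain ⟨-, x, h2, -, h3⟩ := hR (h - j) (by omega) (by omega)
    rw [Nat.sub_sub_self hj.2.le] at h3
    exact ⟨hj.2, x, h2, h3⟩
  -- The interval with label `j` is gap `j - 1`, since gaps are numbered by their lower node.
  · obtain ⟨i, rfl⟩ : ∃ i, j = i + 1 := ⟨j - 1, by omega⟩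
    obtain ⟨h1, x, h2, h3, h4, h5, h6⟩ := hL i (by omega)
    refine ⟨x, ?_, h2⟩
    have hlow := SCM.xPt_lt_of_node_lt hsign h1 h5
    have hupp := SCM.lt_xPt_of_lt_node hsign h1 h6
    have hpos : (0 : EReal) < x := EReal.coe_pos.mpr h3
    have ha : (x : EReal) < (SCM.aBound ρ : ℝ) := EReal.coe_lt_coe_iff.mpr h4
    rw [SCM.intervalL]
    split_ifs at hlow hupp ⊢ with hρ
    · exact ⟨max_lt hlow hpos, lt_min hupp ha⟩
    · rw [show h + 1 - (i + 1) = h - i by omega]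
      exact ⟨max_lt hlow hpos, lt_min hupp ha⟩
  · obtain ⟨h1, x, h2, h4, h5, h6⟩ := hR l hl0 hl
    refine ⟨x, ?_, h2⟩
    have hlow := SCM.xPt_lt_of_node_lt hsign (by omega) h5
    have hupp := SCM.lt_xPt_of_lt_node hsign (by omega) h6
    have hb : ((SCM.bBound ρ : ℝ) : EReal) < x := EReal.coe_lt_coe_iff.mpr h4
    rw [SCM.intervalR]
    split_ifs at hlow hupp ⊢ with hρ
    · rw [show h + 1 - l = h - l + 1 by omega]
      exact ⟨max_lt hb hlow, hupp⟩
    · rw [Nat.sub_sub_self h1] at hlow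
      rw [show h - (h - l + 1) = l - 1 by omega] at hupp
      exact ⟨max_lt hb hlow, hupp⟩
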